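/- **Setting.** Let $I$ (flow types) and $J$ (resources) be finite sets; type $i$ may use the resources in a nonempty set $J(i)\subseteq J$ (routes of length one), resource $j$ has capacity $C_j>0$, and $n_i\ge 0$ is the (fixed) number of flows of type $i$; type $i$ is *active* if $n_i>0$. Let $U$ be a common utility function, strictly increasing on $[0,\infty)$, strictly concave and differentiable on $(0,\infty)$, where $U(0)=-\infty$ is allowed. A rate vector $x=(x_i)_{i\in I}$ is *optimal* if $x_i=0$ whenever $n_i=0$ and $x$, with some $(x_i^j)$, solves $$\max\ \sum_{i} n_iU(x_i)\quad\text{s.t.}\quad \sum_{i:\,j\in J(i)} n_ix_i^j\le C_j\ (j\in J),\qquad \sum_{j\in J(i)}x_i^j=x_i\ (i\in I),\qquad x_i^j\ge 0\ (i\in I,\ j\in J(i)).$$ *Clusters* are the classes of the equivalence relation on active types and resources in which two of them are equivalent if they are joined by a path in the bipartite graph $\{(i,j): x_i^j>0\}$ of some optimal solution; a cluster is written as a pair $(I',J')$. Its rate is the common value of $x_i$, $i\in I'$ ($\infty$ if $I'=\emptyset$), and the clusters with the same rate form a *cluster level*. For $J'\subseteq J$ put $C(J')=\sum_{j\in J'}C_j$,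 $I(J')=\{i\in I: J(i)\subseteq J'\}$ and $r(J')=C(J')/\sum_{i\in I(J')}n_i\in(0,\infty]$. A nonempty $J'$ is *strongly connected* if it cannot be partitioned into nonempty $J_1,J_2$ such that $I(J')$ can be partitioned into (possibly empty) $I_1,I_2$ with $J(i)\cap J_2=\emptyset$ for $i\in I_1$ and $J(i)\cap J_1=\emptyset$ for $i\in I_2$. **Algorithm.** At step $k=1,2,\dots$ let $x_k$ be the minimum of $r(J')$ over the strongly connected $J'\subseteq J$, let $J_k$ be the union of all minimisers, and let $I_k=I(J_k)$. Then replace $I$ by $I\setminus I_k$, $J$ by $J\setminus J_k$, and each $J(i)$ by $J(i)\cap(J\setminus J_k)$. Repeat until no resources and no users are left. **Theorem.** The minimum exists at every step and the algorithm stops after finitely many steps, say $K$; each type lies in exactly one $I_k$ and each resource in exactly one $J_k$. There is exactly one optimal rate vector $x$; it has $x_i=x_k$ for every active $i\in I_k$ (and $x_i=0$ if $n_i=0$). Moreover $x_1<x_2<\dots<x_K$. Every cluster has one of the rates $x_1,\dots,x_K$, and for every $k$ the union of all clusters of rate $x_k$ is the pair consisting of the active types in $I_k$ and of $J_k$. At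 every step $k$, with $I(\cdot)$ and $J(\cdot)$ taken in the network of that step: each strongly connected minimiser $J'$, together with the active types in $I(J')$, is a union of clusters of rate $x_k$; if $J'$ is minimal under inclusion among the minimisers, this pair is a cluster. The pairs (active types in $I(J')$, $J'$) with $J'$ a strongly connected minimiser are exactly the clusters of rate $x_k$ if and only if no type $i\in I_k$ has a set $J(i)$ that meets the resources of two different clusters of rate $x_k$. -/

import Mathlib

open scoped ENNReal

namespace RateAllocation

/-! ## The optimisation problem with routes of length one -/

/-- A common utility function: strictly increasing on `[0, ∞)`, strictly concave and
differentiable on `(0, ∞)`.  Values are extended reals so that `U 0 = -∞` is allowed, as for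
`log x` and `x ^ (1 - α) / (1 - α)` with `1 < α`; strict monotonicity forces all values on
`(0, ∞)` to be finite. -/
structure IsUtility (U : ℝ → EReal) : Prop where
  strictMono : StrictMonoOn U (Set.Ici 0)
  strictConcave : StrictConcaveOn ℝ (Set.Ioi 0) (fun x => (U x).toReal)
  differentiable : DifferentiableOn ℝ (fun x => (U x).toReal) (Set.Ioi 0)

section Allocation

variable {I J : Type*} [Fintype I] [Fintype J] [DecidableEq I] [DecidableEq J]

/-- `y i j` is the rate that each flow of type `i` receives from resource `j`; a flow of type `i`
can only use the resources in `acc i`. -/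
structure IsFeasible (acc : I → Finset J) (C : J → ℝ) (n : I → ℝ) (y : I → J → ℝ) : Prop where
  nonneg : ∀ i, ∀ j ∈ acc i, 0 ≤ y i j
  eq_zero : ∀ i, ∀ j ∉ acc i, y i j = 0
  capacity : ∀ j, ∑ i with j ∈ acc i, n i * y i j ≤ C j

/-- The total rate of a flow of type `i`. -/
def totalRate (acc : I → Finset J) (y : I → J → ℝ) (i : I) : ℝ := ∑ j ∈ acc i, y i j

/-- The aggregate utility of a rate vector (in `EReal`, `0 * ⊥ = 0`). -/
noncomputable def welfare (U : ℝ → EReal) (n : I → ℝ) (x : I → ℝ) : EReal :=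
  ∑ i, (n i : EReal) * U (x i)

/-- A solution `y` of the optimisation problem, with the convention that flow types without
flows have rate zero. -/
structure IsOptimalSplit (acc : I → Finset J) (C : J → ℝ) (n : I → ℝ) (U : ℝ → EReal)
    (y : I → J → ℝ) : Prop where
  feasible : IsFeasible acc C n y
  inactive : ∀ i, n i = 0 → totalRate acc y i = 0
  maximal : ∀ z, IsFeasible acc C n z →
    welfare U n (totalRate acc z) ≤ welfare U n (totalRate acc y)

/-- `x` is an optimal rate vector. -/
def IsOptimalRate (acc : I → Finset J) (C : J → ℝ) (n : I → ℝ) (U : ℝ → EReal)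
    (x : I → ℝ) : Prop :=
  ∃ y, IsOptimalSplit acc C n U y ∧ totalRate acc y = x

/-! ## Clusters and cluster levels -/

/-- The bipartite graph on flow types and resources whose edges are the pairs `i`, `j` with a
strictly positive rate `y i j`. -/
def supportGraph (y : I → J → ℝ) : SimpleGraph (I ⊕ J) where
  Adj v w := (∃ i j, v = Sum.inl i ∧ w = Sum.inr j ∧ 0 < y i j) ∨
    (∃ i j, w = Sum.inl i ∧ v = Sum.inr j ∧ 0 < y i j)
  symm := ⟨fun _ _ h => h.symm⟩
  loopless := ⟨by
    rintro v (⟨i, j, h, h', -⟩ | ⟨i, j, h, h', -⟩) <;> rw [h] at h' <;> cases h'⟩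

/-- Two vertices are joined by a path that has strictly positive rates in some optimal
solution. -/
def Joined (acc : I → Finset J) (C : J → ℝ) (n : I → ℝ) (U : ℝ → EReal) (v w : I ⊕ J) : Prop :=
  ∃ y, IsOptimalSplit acc C n U y ∧ (supportGraph y).Reachable v w

/-- The flow types in `A` that do have flows. -/
noncomputable def active (n : I → ℝ) (A : Finset I) : Finset I :=
  open scoped Classical in {i ∈ A | 0 < n i}

/-- A cluster: a nonempty pair `(I', J')` of flow types having flows and of resources which
consists, for each of its members, of exactly the flow types having flows and the resources that
are joined to that member. -/
structure IsCluster (acc : I → Finset J) (C : J → ℝ) (n : I → ℝ) (U : ℝ → EReal)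
    (I' : Finset I) (J' : Finset J) : Prop where
  nonempty : I'.Nonempty ∨ J'.Nonempty
  active : ∀ i ∈ I', 0 < n i
  mem_users_iff : ∀ v ∈ I'.disjSum J', ∀ i, 0 < n i →
    (i ∈ I' ↔ Joined acc C n U v (Sum.inl i))
  mem_resources_iff : ∀ v ∈ I'.disjSum J', ∀ j,
    (j ∈ J' ↔ Joined acc C n U v (Sum.inr j))

/-- `(I', J')` is a cluster at the cluster level `ρ`: `ρ` is the common rate, in the rate vector
`x`, of all its flow types.  A cluster without flow types has rate `∞`. -/
structure IsClusterAtLevel (acc : I → Finset J) (C : J → ℝ) (n : I → ℝ) (U : ℝ → EReal)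
    (x : I → ℝ) (ρ : ℝ≥0∞) (I' : Finset I) (J' : Finset J) : Prop where
  isCluster : IsCluster acc C n U I' J'
  rate_eq : ∀ i ∈ I', ENNReal.ofReal (x i) = ρ
  rate_empty : I' = ∅ → ρ = ∞

/-- `r(I', J') = C(J') / ∑ i ∈ I', n i`, which is `∞` if `J'` is nonempty and there is no flow in
`I'`. -/
noncomputable def rate (C : J → ℝ) (n : I → ℝ) (I' : Finset I) (J' : Finset J) : ℝ≥0∞ :=
  ENNReal.ofReal (∑ j ∈ J', C j) / ENNReal.ofReal (∑ i ∈ I', n i)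

end Allocation

/-! ## The greedy algorithm -/

/-- The network that is left at some step of the algorithm: the remaining flow types, the
remaining resources, and the sets `J(i)`. -/
structure Network (I J : Type*) where
  users : Finset I
  resources : Finset J
  acc : I → Finset J

namespace Network

variable {I J : Type*} [DecidableEq I] [DecidableEq J]

/-- `I(J')`, the flow types that have to go through `J'`. -/
def inner (N : Network I J) (J' : Finset J) : Finset I := {i ∈ N.users | N.acc i ⊆ J'}

/-- The pair `(I', J')` is connected: `J'` is nonempty and cannot be partitioned into nonempty
`J₁`, `J₂` such that `I'` can be partitioned into `I₁`, `I₂`, where no type in `I₁` can use `J₂`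
and no type in `I₂` can use `J₁`. -/
def IsConnected (N : Network I J) (I' : Finset I) (J' : Finset J) : Prop :=
  J'.Nonempty ∧ ¬ ∃ J₁ J₂ : Finset J, J₁.Nonempty ∧ J₂.Nonempty ∧ Disjoint J₁ J₂ ∧ J₁ ∪ J₂ = J' ∧
    ∃ I₁ I₂ : Finset I, Disjoint I₁ I₂ ∧ I₁ ∪ I₂ = I' ∧
      (∀ i ∈ I₁, Disjoint (N.acc i) J₂) ∧ (∀ i ∈ I₂, Disjoint (N.acc i) J₁)

/-- The strongly connected sets of resources. -/
noncomputable def strong (N : Network I J) : Finset (Finset J) :=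
  open scoped Classical in {J' ∈ N.resources.powerset | N.IsConnected (N.inner J') J'}

/-- The minimum of `r(I(J'), J')` over the strongly connected sets `J'`. -/
noncomputable def minRate (N : Network I J) (C : J → ℝ) (n : I → ℝ) : ℝ≥0∞ :=
  N.strong.inf fun J' => rate C n (N.inner J') J'

/-- The strongly connected sets that achieve the minimum. -/
noncomputable def minimisers (N : Network I J) (C : J → ℝ) (n : I → ℝ) : Finset (Finset J) :=
  open scoped Classical in {J' ∈ N.strong | rate C n (N.inner J') J' = N.minRate C n}

/-- The union of all the sets that achieve the minimum. -/
noncomputable def levelResources (N : Network I J) (C : J → ℝ) (n : I → ℝ) : Finset J :=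
  (N.minimisers C n).biUnion id

/-- The flow types that have to go through this union. -/
noncomputable def levelUsers (N : Network I J) (C : J → ℝ) (n : I → ℝ) : Finset I :=
  N.inner (N.levelResources C n)

/-- The reduced network. -/
noncomputable def next (N : Network I J) (C : J → ℝ) (n : I → ℝ) : Network I J where
  users := N.users \ N.levelUsers C n
  resources := N.resources \ N.levelResources C n
  acc i := N.acc i ∩ (N.resources \ N.levelResources C n)

/-- The algorithm stops at a network without resources and users. -/
def IsDone (N : Network I J) : Prop := N.resources = ∅ ∧ N.users = ∅

end Network

/-- The network left after `k` steps of the algorithm, so that `stage acc C n 0` is the given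
network and step `k + 1` works on `stage acc C n k`. -/
noncomputable def stage {I J : Type*} [Fintype I] [Fintype J] [DecidableEq I] [DecidableEq J]
    (acc : I → Finset J) (C : J → ℝ) (n : I → ℝ) : ℕ → Network I J
  | 0 => ⟨Finset.univ, Finset.univ, acc⟩
  | k + 1 => (stage acc C n k).next C n

end RateAllocation

/-! Call a feasible allocation balanced if inactive types get nothing, every resource open to an
active type is full, and only the slowest types that can use a resource do use it. One exists, as a
minimiser of `∑ n i * (M - x i) ^ 2` with `M` large (`exists_isBalanced`). Pricing each resource at
the marginal utility of its users certifies that a balanced allocation is optimal, and strict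
concavity makes the optimal rates unique (`IsBalanced.isOptimalSplit_iff`). From there on the
utility plays no role: optimal means feasible with these rates.

Averaging optimal allocations unites their supports, so one of them, the saturated one, has the
largest support (`exists_isSaturated`). The clusters are the components of its support graph.

The level of a resource is the smallest rate of the active types that can use it; positive rates
join only types and resources of equal level. The algorithm removes the levels in increasing order.
Let `t` be the next level above `s`, `L` a set of resources above `s`, and `A` the remaining types
confined to `L`. For finite `t`, the difference `C(L) - t * n(A)` is the sum of the excesses `n i *
(x i - t)` over `A` and of the capacities in `L` that `A` leaves over. These are nonnegative, so the
rate of `L` is at least `t`, with equality exactly when `L` is tight (`IsNextLevel.rate_spec`).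
Tight sets are covered by strongly connected tight subsets (`IsTight.exists_strong`) and the whole
level is tight, so the minimum is `t` and the minimisers exhaust the level.

A tight set is a union of components. If it is minimal, any two of its resources are linked by
possible moves of rate, so every such move lies on a cycle; rotating a little rate around the cycle
changes neither loads nor rates, so saturation makes all these pairs positive and the set is one
component (`IsSaturated.pos_of_cycle`). For the last equivalence, a type meeting several clusters
would glue them into a further minimiser, while without such types every minimiser splits along its
clusters. -/

namespace RateAllocation

open Filter Topology

set_option linter.unusedSectionVars false

/-! ## Utility functions -/

namespace IsUtility

variable {U : ℝ → EReal}

lemma coe_toReal (hU : IsUtility U) {c : ℝ} (hc : 0 < c) : ((U c).toReal : EReal) = U c := by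
  refine EReal.coe_toReal (ne_of_lt ?_) (ne_of_gt ?_)
  · exact lt_of_lt_of_le (hU.strictMono (Set.mem_Ici.2 hc.le)
      (Set.mem_Ici.2 (by linarith)) (lt_add_one c)) le_top
  · exact lt_of_le_of_lt bot_le (hU.strictMono (Set.mem_Ici.2 le_rfl) (Set.mem_Ici.2 hc.le) hc)

lemma toReal_lt_tangent (hU : IsUtility U) {c x : ℝ} (hc : 0 < c) (hx : 0 < x) (hxc : x ≠ c) :
    (U x).toReal < (U c).toReal + deriv (fun x => (U x).toReal) c * (x - c) := by
  have hd : DifferentiableAt ℝ (fun x => (U x).toReal) c :=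
    hU.differentiable.differentiableAt (Ioi_mem_nhds hc)
  rcases lt_or_gt_of_ne hxc with h | h
  · have := hU.strictConcave.deriv_lt_slope (Set.mem_Ioi.2 hx) (Set.mem_Ioi.2 hc) h hd
    rw [slope_def_field, lt_div_iff₀ (by linarith)] at this
    linarith
  · have := hU.strictConcave.slope_lt_deriv (Set.mem_Ioi.2 hc) (Set.mem_Ioi.2 hx) h hd
    rw [slope_def_field, div_lt_iff₀ (by linarith)] at this
    linarith

lemma toReal_le_tangent (hU : IsUtility U) {c x : ℝ} (hc : 0 < c) (hx : 0 < x) :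
    (U x).toReal ≤ (U c).toReal + deriv (fun x => (U x).toReal) c * (x - c) := by
  rcases eq_or_ne x c with rfl | h
  · simp
  · exact (hU.toReal_lt_tangent hc hx h).le

lemma deriv_pos (hU : IsUtility U) {c : ℝ} (hc : 0 < c) :
    0 < deriv (fun x => (U x).toReal) c := by
  have h1 := hU.toReal_le_tangent hc (x := c + 1) (by linarith)
  have h2 : U c < U (c + 1) :=
    hU.strictMono (Set.mem_Ici.2 hc.le) (Set.mem_Ici.2 (by linarith)) (lt_add_one c)
  rw [← hU.coe_toReal hc, ← hU.coe_toReal (c := c + 1) (by linarith), EReal.coe_lt_coe_iff] at h2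
  linarith

/-- Adding the tangent inequalities at the two points, each evaluated at the other, compares the
slopes. -/
lemma deriv_antitoneOn (hU : IsUtility U) :
    AntitoneOn (deriv (fun x => (U x).toReal)) (Set.Ioi 0) := by
  intro c hc c' hc' h
  rcases h.eq_or_lt with rfl | h
  · exact le_rfl
  have h1 := hU.toReal_le_tangent (c := c) (x := c') hc hc'
  have h2 := hU.toReal_le_tangent (c := c') (x := c) hc' hc
  by_contra! h3
  nlinarith

/-- The tangent at a positive point lies strictly above the utility function, also at `0`. -/
lemma lt_tangent (hU : IsUtility U) {c x : ℝ} (hc : 0 < c) (hx : 0 ≤ x) (hxc : x ≠ c) :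
    U x < (((U c).toReal + deriv (fun x => (U x).toReal) c * (x - c) : ℝ) : EReal) := by
  rcases hx.eq_or_lt with rfl | hx
  · set u := fun x => (U x).toReal with hu
    have h1 := hU.toReal_lt_tangent hc (x := c / 2) (by linarith) (by linarith)
    -- Continuity at `0` is not assumed; monotonicity replaces it. If `U 0` were larger, the tangent
    -- at `c / 2`, whose slope is at least that at `c`, would force `U δ < U 0` for a small `δ > 0`.
    -- Working at `c / 2` keeps the strict inequality `h1` in reserve.
    have key : U 0 ≤ ((u (c / 2) - deriv u c * (c / 2) : ℝ) : EReal) := by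
      by_contra! h
      have hlt : U 0 < U (c / 2) := hU.strictMono (Set.mem_Ici.2 le_rfl)
        (Set.mem_Ici.2 (by linarith)) (by linarith)
      rw [← hU.coe_toReal (c := c / 2) (by linarith)] at hlt
      have h0 : ((U 0).toReal : EReal) = U 0 :=
        EReal.coe_toReal (ne_top_of_lt hlt) (ne_bot_of_gt h)
      rw [← h0, EReal.coe_lt_coe_iff] at h
      have hp := hU.deriv_pos hc
      set p := deriv u c
      obtain ⟨δ, hδ0, hδ1, hδ2⟩ : ∃ δ : ℝ, 0 < δ ∧ δ < c / 2 ∧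
          p * δ < (U 0).toReal - (u (c / 2) - p * (c / 2)) := by
        refine ⟨min (c / 4) (((U 0).toReal - (u (c / 2) - p * (c / 2))) / (2 * p)), ?_, ?_, ?_⟩
        · apply lt_min (by linarith)
          apply div_pos (by linarith) (by linarith)
        · exact lt_of_le_of_lt (min_le_left _ _) (by linarith)
        · have := mul_le_mul_of_nonneg_left (min_le_right (c / 4)
            (((U 0).toReal - (u (c / 2) - p * (c / 2))) / (2 * p))) hp.le
          have h2 : p * (((U 0).toReal - (u (c / 2) - p * (c / 2))) / (2 * p)) =
            ((U 0).toReal - (u (c / 2) - p * (c / 2))) / 2 := by field_simp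
          linarith
      have ha : p ≤ deriv u (c / 2) :=
        hU.deriv_antitoneOn (a := c / 2) (b := c) (Set.mem_Ioi.2 (by linarith)) hc (by linarith)
      have h3 := hU.toReal_le_tangent (c := c / 2) (x := δ) (by linarith) hδ0
      have h4 : U 0 < U δ := hU.strictMono (Set.mem_Ici.2 le_rfl) (Set.mem_Ici.2 hδ0.le) hδ0
      rw [← h0, ← hU.coe_toReal hδ0, EReal.coe_lt_coe_iff] at h4
      change (U δ).toReal ≤ u (c / 2) + deriv u (c / 2) * (δ - c / 2) at h3
      nlinarith
    refine lt_of_le_of_lt key ?_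
    rw [EReal.coe_lt_coe_iff]
    change u (c / 2) < u c + deriv u c * (c / 2 - c) at h1
    change _ < u c + _
    linarith
  · rw [← hU.coe_toReal hx, EReal.coe_lt_coe_iff]
    exact hU.toReal_lt_tangent hc hx hxc

end IsUtility

variable {I J : Type*} [Fintype I] [Fintype J] [DecidableEq I] [DecidableEq J]
  {acc : I → Finset J} {C : J → ℝ} {n : I → ℝ} {U : ℝ → EReal} {y z : I → J → ℝ}

/-! ## Feasible allocations -/

namespace IsFeasible

lemma apply_nonneg (hy : IsFeasible acc C n y) (i : I) (j : J) : 0 ≤ y i j := by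
  by_cases h : j ∈ acc i
  · exact hy.nonneg i j h
  · exact (hy.eq_zero i j h).ge

lemma mem_acc (hy : IsFeasible acc C n y) {i : I} {j : J} (h : 0 < y i j) : j ∈ acc i := by
  by_contra hj
  exact h.ne' (hy.eq_zero i j hj)

lemma totalRate_eq (hy : IsFeasible acc C n y) (i : I) : totalRate acc y i = ∑ j, y i j :=
  Finset.sum_subset (Finset.subset_univ _) fun j _ hj => hy.eq_zero i j hj

lemma totalRate_nonneg (hy : IsFeasible acc C n y) (i : I) : 0 ≤ totalRate acc y i :=
  Finset.sum_nonneg fun j hj => hy.nonneg i j hj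

end IsFeasible

lemma sum_filter_mem_acc (hy : ∀ i, ∀ j ∉ acc i, y i j = 0) (j : J) :
    ∑ i with j ∈ acc i, n i * y i j = ∑ i, n i * y i j := by
  rw [Finset.sum_filter]
  refine Finset.sum_congr rfl fun i _ => ?_
  split_ifs with h
  · rfl
  · rw [hy i j h, mul_zero]

lemma IsFeasible.load_le (hy : IsFeasible acc C n y) (j : J) : ∑ i, n i * y i j ≤ C j := by
  rw [← sum_filter_mem_acc hy.eq_zero]
  exact hy.capacity j

/-- A direction along which one can move from `y` without violating the constraints. -/
lemma IsFeasible.eventually_add_smul (hy : IsFeasible acc C n y) {d : I → J → ℝ}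
    (h0 : ∀ i, ∀ j ∉ acc i, d i j = 0) (h1 : ∀ i j, y i j = 0 → 0 ≤ d i j)
    (h2 : ∀ j, ∑ i, n i * y i j = C j → ∑ i, n i * d i j ≤ 0) :
    ∀ᶠ ε in 𝓝[>] (0 : ℝ), IsFeasible acc C n (y + ε • d) := by
  have hnn : ∀ᶠ ε in 𝓝[>] (0 : ℝ), ∀ i j, 0 ≤ y i j + ε * d i j := by
    refine eventually_all.2 fun i => eventually_all.2 fun j => ?_
    rcases (hy.apply_nonneg i j).eq_or_lt with h | h
    · filter_upwards [self_mem_nhdsWithin] with ε hε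
      rw [← h, zero_add]
      exact mul_nonneg (le_of_lt hε) (h1 i j h.symm)
    · have : Tendsto (fun ε : ℝ => y i j + ε * d i j) (𝓝[>] 0) (𝓝 (y i j + 0 * d i j)) :=
        (Continuous.tendsto (by fun_prop) 0).mono_left nhdsWithin_le_nhds
      filter_upwards [this.eventually (lt_mem_nhds (by simpa using h))] with ε hε using hε.le
  have hcap : ∀ᶠ ε in 𝓝[>] (0 : ℝ), ∀ j, ∑ i, n i * y i j + ε * ∑ i, n i * d i j ≤ C j := by
    refine eventually_all.2 fun j => ?_
    rcases (hy.load_le j).eq_or_lt with h | h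
    · filter_upwards [self_mem_nhdsWithin] with ε hε
      have := mul_nonpos_of_nonneg_of_nonpos (le_of_lt (Set.mem_Ioi.1 hε)) (h2 j h)
      linarith
    · have : Tendsto (fun ε : ℝ => ∑ i, n i * y i j + ε * ∑ i, n i * d i j) (𝓝[>] 0)
          (𝓝 (∑ i, n i * y i j + 0 * ∑ i, n i * d i j)) :=
        (Continuous.tendsto (by fun_prop) 0).mono_left nhdsWithin_le_nhds
      filter_upwards [this.eventually (gt_mem_nhds (by simpa using h))] with ε hε using hε.le
  filter_upwards [hnn, hcap] with ε hε1 hε2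
  have hz : ∀ i, ∀ j ∉ acc i, (y + ε • d) i j = 0 := fun i j hj => by
    simp [hy.eq_zero i j hj, h0 i j hj]
  refine ⟨fun i j _ => by simpa using hε1 i j, hz, fun j => ?_⟩
  rw [sum_filter_mem_acc hz]
  refine le_of_eq_of_le ?_ (hε2 j)
  rw [Finset.mul_sum, ← Finset.sum_add_distrib]
  refine Finset.sum_congr rfl fun i _ => ?_
  simp only [Pi.add_apply, Pi.smul_apply, smul_eq_mul]
  ring

/-! ## Balanced allocations -/

/-- The allocations in which every usable resource is used fully, and only by the flow types with
the smallest rate among those that can use it. -/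
structure IsBalanced (acc : I → Finset J) (C : J → ℝ) (n : I → ℝ) (y : I → J → ℝ) : Prop where
  feasible : IsFeasible acc C n y
  inactive : ∀ i, n i = 0 → ∀ j, y i j = 0
  full : ∀ i, 0 < n i → ∀ j ∈ acc i, ∑ i', n i' * y i' j = C j
  fair : ∀ i, 0 < n i → ∀ j ∈ acc i, ∀ i', 0 < y i' j → totalRate acc y i' ≤ totalRate acc y i

/-- The direction which increases the rate of type `i` at resource `j`. -/
def unitDir (i : I) (j : J) : I → J → ℝ := Pi.single i (Pi.single j 1)

lemma unitDir_nonneg (i : I) (j : J) (k : I) (l : J) : 0 ≤ unitDir i j k l := by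
  unfold unitDir
  rcases eq_or_ne k i with rfl | h
  · rcases eq_or_ne l j with rfl | h' <;> simp [*]
  · simp [h]

lemma unitDir_self (i : I) (j : J) : unitDir i j i j = 1 := by
  simp [unitDir]

lemma unitDir_eq_zero {i k : I} {j l : J} (h : ¬ (k = i ∧ l = j)) : unitDir i j k l = 0 := by
  unfold unitDir
  rcases eq_or_ne k i with rfl | hk
  · simp [show l ≠ j from fun hl => h ⟨rfl, hl⟩]
  · simp [hk]

lemma sum_unitDir (i : I) (j : J) (k : I) : ∑ l, unitDir i j k l = if k = i then 1 else 0 := by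
  unfold unitDir
  rcases eq_or_ne k i with rfl | hk
  · simp
  · simp [hk]

lemma load_unitDir (n : I → ℝ) (i : I) (j l : J) :
    ∑ k, n k * unitDir i j k l = if l = j then n i else 0 := by
  rw [Finset.sum_eq_single i]
  · rcases eq_or_ne l j with rfl | hl <;> simp [unitDir, *]
  · intro k _ hk
    simp [unitDir, hk]
  · simp

/-! ### Existence of balanced allocations by least squares -/

lemma isCompact_setOf_feasible (hn : ∀ i, 0 ≤ n i) :
    IsCompact {y | IsFeasible acc C n y ∧ ∀ i, n i = 0 → ∀ j, y i j = 0} := by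
  have heq : {y | IsFeasible acc C n y ∧ ∀ i, n i = 0 → ∀ j, y i j = 0} =
      {y | (∀ i, ∀ j ∈ acc i, 0 ≤ y i j) ∧ (∀ i, ∀ j ∉ acc i, y i j = 0) ∧
        (∀ j, ∑ i with j ∈ acc i, n i * y i j ≤ C j) ∧ ∀ i, n i = 0 → ∀ j, y i j = 0} := by
    ext y
    exact ⟨fun h => ⟨h.1.1, h.1.2, h.1.3, h.2⟩, fun h => ⟨⟨h.1, h.2.1, h.2.2.1⟩, h.2.2.2⟩⟩
  have hclosed : IsClosed {y | IsFeasible acc C n y ∧ ∀ i, n i = 0 → ∀ j, y i j = 0} := by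
    rw [heq]
    simp only [Set.ofPred_and, Set.ofPred_forall]
    refine IsClosed.inter ?_ (IsClosed.inter ?_ (IsClosed.inter ?_ ?_))
    · exact isClosed_iInter fun i => isClosed_iInter fun j => isClosed_iInter fun _ =>
        isClosed_le (by fun_prop) (by fun_prop)
    · exact isClosed_iInter fun i => isClosed_iInter fun j => isClosed_iInter fun _ =>
        isClosed_eq (by fun_prop) (by fun_prop)
    · exact isClosed_iInter fun j => isClosed_le (by fun_prop) (by fun_prop)
    · exact isClosed_iInter fun i => isClosed_iInter fun _ => isClosed_iInter fun j =>
        isClosed_eq (by fun_prop) (by fun_prop)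
  -- For `n i = 0` the bound `C j / n i` is `0`, which is right because inactive types have rate
  -- zero here.
  refine (isCompact_Icc (a := (0 : I → J → ℝ)) (b := fun i j => C j / n i)).of_isClosed_subset
    hclosed ?_
  rintro y ⟨hy, h0⟩
  refine ⟨fun i j => hy.apply_nonneg i j, fun i j => ?_⟩
  rcases (hn i).eq_or_lt with h | h
  · simp [h0 i h.symm, ← h]
  · rw [le_div_iff₀ h, mul_comm]
    exact le_trans (Finset.single_le_sum (f := fun i => n i * y i j)
      (fun k _ => mul_nonneg (hn k) (hy.apply_nonneg k j)) (Finset.mem_univ i)) (hy.load_le j)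

/-- The first-order condition for the minimum of a weighted sum of squares. -/
lemma first_order {S : Set (I → J → ℝ)} {M : ℝ}
    (hmin : IsMinOn (fun y : I → J → ℝ => ∑ i, n i * (M - ∑ j, y i j) ^ 2) S y)
    {d : I → J → ℝ} (hd : ∀ᶠ ε in 𝓝[>] (0 : ℝ), y + ε • d ∈ S) :
    ∑ i, n i * (M - ∑ j, y i j) * ∑ j, d i j ≤ 0 := by
  have key : ∀ᶠ ε in 𝓝[>] (0 : ℝ), 2 * ∑ i, n i * (M - ∑ j, y i j) * ∑ j, d i j ≤
      ε * ∑ i, n i * (∑ j, d i j) ^ 2 := by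
    filter_upwards [hd, self_mem_nhdsWithin] with ε hε hpos
    have h := hmin hε
    simp only [Set.mem_ofPred_eq] at h
    have h2 : ∑ i, n i * (M - ∑ j, (y + ε • d) i j) ^ 2 = ∑ i, n i * (M - ∑ j, y i j) ^ 2 -
        ε * (2 * ∑ i, n i * (M - ∑ j, y i j) * ∑ j, d i j) +
        ε * (ε * ∑ i, n i * (∑ j, d i j) ^ 2) := by
      simp only [Finset.mul_sum, ← Finset.sum_sub_distrib, ← Finset.sum_add_distrib]
      refine Finset.sum_congr rfl fun i _ => ?_
      have : ∑ j, (y + ε • d) i j = ∑ j, y i j + ε * ∑ j, d i j := by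
        simp [Finset.sum_add_distrib, Finset.mul_sum]
      rw [this]
      simp only [← Finset.mul_sum]
      ring
    rw [h2] at h
    exact le_of_mul_le_mul_left (by linarith) (Set.mem_Ioi.1 hpos)
  have hlim : Tendsto (fun ε : ℝ => ε * ∑ i, n i * (∑ j, d i j) ^ 2) (𝓝[>] 0)
      (𝓝 (0 * ∑ i, n i * (∑ j, d i j) ^ 2)) :=
    (Continuous.tendsto (by fun_prop) 0).mono_left nhdsWithin_le_nhds
  have := ge_of_tendsto hlim key
  linarith

/-- At a minimum of the weighted squared distance of the rates to `M`, spare capacity at a usable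
resource could still raise a rate, and a faster user could still cede capacity to a slower type. The
first-order condition excludes both. -/
theorem exists_isBalanced (acc : I → Finset J) (hC : ∀ j, 0 < C j) (hn : ∀ i, 0 ≤ n i) :
    ∃ y, IsBalanced acc C n y := by
  set S := {y | IsFeasible acc C n y ∧ ∀ i, n i = 0 → ∀ j, y i j = 0} with hS
  -- Larger than any feasible rate of an active type, so the objective decreases in every active
  -- rate; inactive types contribute `0` to the sum.
  set M := 1 + ∑ i, ∑ j, C j / n i with hM
  have hne : S.Nonempty := ⟨0, ⟨by simp, by simp, fun j => by simpa using (hC j).le⟩, by simp⟩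
  obtain ⟨y, ⟨hy, hy0⟩, hmin⟩ := (isCompact_setOf_feasible (acc := acc) (C := C) hn).exists_isMinOn
    hne (f := fun y : I → J → ℝ => ∑ i, n i * (M - ∑ j, y i j) ^ 2)
    (Continuous.continuousOn (by fun_prop))
  have hlt : ∀ i, 0 < n i → ∑ j, y i j < M := by
    intro i hi
    have h1 : ∑ j, y i j ≤ ∑ j, C j / n i := by
      refine Finset.sum_le_sum fun j _ => ?_
      rw [le_div_iff₀ hi, mul_comm]
      exact le_trans (Finset.single_le_sum (f := fun i => n i * y i j)
        (fun k _ => mul_nonneg (hn k) (hy.apply_nonneg k j)) (Finset.mem_univ i)) (hy.load_le j)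
    have h2 : ∑ j, C j / n i ≤ ∑ i, ∑ j, C j / n i :=
      Finset.single_le_sum (f := fun i => ∑ j, C j / n i)
        (fun k _ => Finset.sum_nonneg fun j _ => div_nonneg (hC j).le (hn k)) (Finset.mem_univ i)
    linarith
  have hpos : ∀ {i j}, 0 < y i j → 0 < n i := fun {i j} h =>
    (hn i).lt_of_ne fun h0 => h.ne' (hy0 i h0.symm j)
  refine ⟨y, hy, hy0, fun i hi j hj => ?_, fun i hi j hj k hk => ?_⟩
  · by_contra hne
    have hd := hy.eventually_add_smul (d := unitDir i j)
      (fun k l hl => unitDir_eq_zero (by rintro ⟨rfl, rfl⟩; exact hl hj))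
      (fun k l _ => unitDir_nonneg i j k l) (fun l hl => by
        rw [load_unitDir, if_neg]
        rintro rfl
        exact hne hl)
    have := first_order hmin (d := unitDir i j) (hd.mono fun ε hε => ⟨hε, fun k hk l => by
      have : k ≠ i := by rintro rfl; exact hi.ne' hk
      simp [hy0 k hk l, unitDir, this]⟩)
    simp only [sum_unitDir, mul_ite, mul_one, mul_zero, Finset.sum_ite_eq', Finset.mem_univ,
      if_true] at this
    have := mul_pos hi (sub_pos.2 (hlt i hi))
    linarith
  · have hk' := hpos hk
    -- One unit of the capacity of `j` passes from `k` to `i`; the weights keep the load unchanged.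
    set d : I → J → ℝ := (n i)⁻¹ • unitDir i j - (n k)⁻¹ • unitDir k j with hd
    have hdv : ∀ a b, d a b = (n i)⁻¹ * unitDir i j a b - (n k)⁻¹ * unitDir k j a b := by
      simp [hd]
    have hev := hy.eventually_add_smul (d := d)
      (fun a b hb => by
        rw [hdv, unitDir_eq_zero (by rintro ⟨rfl, rfl⟩; exact hb hj),
          unitDir_eq_zero (by rintro ⟨rfl, rfl⟩; exact hb (hy.mem_acc hk))]
        simp)
      (fun a b hb => by
        rw [hdv, unitDir_eq_zero (i := k) (by rintro ⟨rfl, rfl⟩; exact hk.ne' hb)]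
        simpa using mul_nonneg (inv_nonneg.2 hi.le) (unitDir_nonneg i j a b))
      (fun l _ => by
        have h1 := load_unitDir n i j l
        have h2 := load_unitDir n k j l
        have : ∑ a, n a * d a l = (n i)⁻¹ * ∑ a, n a * unitDir i j a l -
            (n k)⁻¹ * ∑ a, n a * unitDir k j a l := by
          rw [Finset.mul_sum, Finset.mul_sum, ← Finset.sum_sub_distrib]
          refine Finset.sum_congr rfl fun a _ => ?_
          rw [hdv]
          ring
        rw [this, h1, h2]
        split_ifs
        · rw [inv_mul_cancel₀ hi.ne', inv_mul_cancel₀ hk'.ne', sub_self]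
        · simp)
    have := first_order hmin (d := d) (hev.mono fun ε hε => ⟨hε, fun a ha l => by
      have h1 : a ≠ i := by rintro rfl; exact hi.ne' ha
      have h2 : a ≠ k := by rintro rfl; exact hk'.ne' ha
      simp [hy0 a ha l, hdv, unitDir, h1, h2]⟩)
    have hsum : ∀ a, ∑ l, d a l =
        (n i)⁻¹ * (if a = i then 1 else 0) - (n k)⁻¹ * (if a = k then 1 else 0) := by
      intro a
      rw [← sum_unitDir i j a, ← sum_unitDir k j a, Finset.mul_sum, Finset.mul_sum,
        ← Finset.sum_sub_distrib]
      exact Finset.sum_congr rfl fun l _ => hdv a l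
    simp only [hsum, mul_sub, Finset.sum_sub_distrib, mul_ite, mul_one, mul_zero,
      Finset.sum_ite_eq', Finset.mem_univ, if_true] at this
    rw [hy.totalRate_eq, hy.totalRate_eq]
    field_simp at this
    linarith

/-! ### Shadow prices and optimality of balanced allocations -/

namespace IsBalanced

lemma totalRate_eq_zero (hy : IsBalanced acc C n y) {i : I} (hi : n i = 0) :
    totalRate acc y i = 0 :=
  Finset.sum_eq_zero fun j _ => hy.inactive i hi j

lemma active_of_pos (hy : IsBalanced acc C n y) (hn : ∀ i, 0 ≤ n i) {i : I} {j : J}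
    (h : 0 < y i j) : 0 < n i :=
  (hn i).lt_of_ne fun h0 => h.ne' (hy.inactive i h0.symm j)

lemma exists_pos (hy : IsBalanced acc C n y) (hC : ∀ j, 0 < C j) (hn : ∀ i, 0 ≤ n i) {i : I}
    {j : J} (hi : 0 < n i) (hj : j ∈ acc i) : ∃ k, 0 < y k j := by
  by_contra! h
  have h1 := hy.full i hi j hj
  have h2 : ∑ i', n i' * y i' j ≤ 0 :=
    Finset.sum_nonpos fun k _ => mul_nonpos_of_nonneg_of_nonpos (hn k) (h k)
  linarith [hC j]

lemma le_totalRate (hy : IsBalanced acc C n y) (i : I) (j : J) : y i j ≤ totalRate acc y i := by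
  rw [hy.feasible.totalRate_eq]
  exact Finset.single_le_sum (fun l _ => hy.feasible.apply_nonneg i l) (Finset.mem_univ j)

/-- Any resource open to `i` is full, hence has a user with a positive rate, and by fairness that
user is no faster than `i`. -/
lemma totalRate_pos (hy : IsBalanced acc C n y) (hacc : ∀ i, (acc i).Nonempty)
    (hC : ∀ j, 0 < C j) (hn : ∀ i, 0 ≤ n i) {i : I} (hi : 0 < n i) : 0 < totalRate acc y i := by
  obtain ⟨j, hj⟩ := hacc i
  obtain ⟨k, hk⟩ := hy.exists_pos hC hn hi hj
  exact hk.trans_le ((hy.le_totalRate k j).trans (hy.fair i hi j hj k hk))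

/-- The shadow prices of the resources, for a decreasing function `p` of the rates. -/
lemma exists_price (hy : IsBalanced acc C n y) (hacc : ∀ i, (acc i).Nonempty)
    (hC : ∀ j, 0 < C j) (hn : ∀ i, 0 ≤ n i) {p : ℝ → ℝ} (hp : AntitoneOn p (Set.Ioi 0)) :
    ∃ q : J → ℝ, (∀ i j, 0 < n i → j ∈ acc i → p (totalRate acc y i) ≤ q j) ∧
      ∀ i j, 0 < y i j → q j = p (totalRate acc y i) := by
  have h : ∀ j, ∃ q : ℝ, (∀ i, 0 < n i → j ∈ acc i → p (totalRate acc y i) ≤ q) ∧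
      ∀ i, 0 < y i j → q = p (totalRate acc y i) := by
    intro j
    by_cases hk : ∃ k, 0 < y k j
    · obtain ⟨k, hk⟩ := hk
      have hkn := hy.active_of_pos hn hk
      refine ⟨p (totalRate acc y k), fun i hi hj => ?_, fun i hij => ?_⟩
      · exact hp (hy.totalRate_pos hacc hC hn hkn) (hy.totalRate_pos hacc hC hn hi)
          (hy.fair i hi j hj k hk)
      · rw [le_antisymm (hy.fair k hkn j (hy.feasible.mem_acc hk) i hij)
          (hy.fair i (hy.active_of_pos hn hij) j (hy.feasible.mem_acc hij) k hk)]
    -- A resource without users is open to no active type, so any price would do.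
    · refine ⟨0, fun i hi hj => absurd (hy.exists_pos hC hn hi hj) hk, fun i hij =>
        absurd ⟨i, hij⟩ hk⟩
  choose q hq using h
  exact ⟨q, fun i j => (hq j).1 i, fun i j => (hq j).2 i⟩

/-- The duality gap as the sum of the two complementary slackness defects: use of resources that are
too expensive, and capacity of priced resources left idle. -/
lemma price_gap (hy : IsBalanced acc C n y) (hz : IsFeasible acc C n z) {p : ℝ → ℝ} {q : J → ℝ}
    (hq : ∀ i j, 0 < y i j → q j = p (totalRate acc y i)) :
    ∑ i, n i * p (totalRate acc y i) * (totalRate acc y i - totalRate acc z i) =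
      ∑ j, ∑ i, n i * ((q j - p (totalRate acc y i)) * z i j) +
      ∑ j, q j * (∑ i, n i * y i j - ∑ i, n i * z i j) := by
  simp only [hy.feasible.totalRate_eq, hz.totalRate_eq] at hq ⊢
  simp only [← Finset.sum_sub_distrib, Finset.mul_sum]
  rw [Finset.sum_comm, ← Finset.sum_add_distrib]
  refine Finset.sum_congr rfl fun j _ => ?_
  rw [← Finset.sum_add_distrib]
  refine Finset.sum_congr rfl fun i _ => ?_
  rcases (hy.feasible.apply_nonneg i j).eq_or_lt with h | h
  · rw [← h]
    ring
  · rw [hq i j h]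
    ring

lemma price_user_nonneg (hn : ∀ i, 0 ≤ n i) (hz : IsFeasible acc C n z) {p : ℝ → ℝ} {q : J → ℝ}
    {x : I → ℝ} (hq : ∀ i j, 0 < n i → j ∈ acc i → p (x i) ≤ q j) (i : I) (j : J) :
    0 ≤ n i * ((q j - p (x i)) * z i j) := by
  rcases (hn i).eq_or_lt with h | h
  · simp [← h]
  · by_cases hj : j ∈ acc i
    · exact mul_nonneg h.le (mul_nonneg (sub_nonneg.2 (hq i j h hj)) (hz.apply_nonneg i j))
    · simp [hz.eq_zero i j hj]

lemma price_load_nonneg (hy : IsBalanced acc C n y) (hacc : ∀ i, (acc i).Nonempty)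
    (hC : ∀ j, 0 < C j) (hn : ∀ i, 0 ≤ n i)
    (hz : IsFeasible acc C n z) {p : ℝ → ℝ} (hp : ∀ c, 0 < c → 0 < p c) {q : J → ℝ}
    (hq : ∀ i j, 0 < n i → j ∈ acc i → p (totalRate acc y i) ≤ q j) (j : J) :
    0 ≤ q j * (∑ i, n i * y i j - ∑ i, n i * z i j) := by
  by_cases h : ∃ i, 0 < n i ∧ j ∈ acc i
  · obtain ⟨i, hi, hj⟩ := h
    rw [hy.full i hi j hj]
    exact mul_nonneg ((hp _ (hy.totalRate_pos hacc hC hn hi)).le.trans (hq i j hi hj))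
      (sub_nonneg.2 (hz.load_le j))
  · have : ∀ {w}, IsFeasible acc C n w → ∑ i, n i * w i j = 0 := fun {w} hw =>
      Finset.sum_eq_zero fun i _ => by
        rcases (hn i).eq_or_lt with h' | h'
        · simp [← h']
        · rw [hw.eq_zero i j fun hj => h ⟨i, h', hj⟩, mul_zero]
    rw [this hy.feasible, this hz]
    simp

/-- The variational inequality behind optimality; `p` will be the marginal utility. -/
lemma sum_price_nonneg (hy : IsBalanced acc C n y) (hacc : ∀ i, (acc i).Nonempty)
    (hC : ∀ j, 0 < C j) (hn : ∀ i, 0 ≤ n i) (hz : IsFeasible acc C n z) {p : ℝ → ℝ}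
    (hp : AntitoneOn p (Set.Ioi 0)) (hp0 : ∀ c, 0 < c → 0 < p c) :
    0 ≤ ∑ i, n i * p (totalRate acc y i) * (totalRate acc y i - totalRate acc z i) := by
  obtain ⟨q, hq1, hq2⟩ := hy.exists_price hacc hC hn hp
  rw [hy.price_gap hz hq2]
  exact add_nonneg (Finset.sum_nonneg fun j _ => Finset.sum_nonneg fun i _ =>
    price_user_nonneg hn hz hq1 i j)
    (Finset.sum_nonneg fun j _ => hy.price_load_nonneg hacc hC hn hz hp0 hq1 j)

/-- A feasible allocation with the rates of a balanced one is balanced. -/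
theorem of_totalRate_eq (hy : IsBalanced acc C n y) (hacc : ∀ i, (acc i).Nonempty)
    (hC : ∀ j, 0 < C j) (hn : ∀ i, 0 ≤ n i) (hz : IsFeasible acc C n z)
    (h : totalRate acc z = totalRate acc y) : IsBalanced acc C n z := by
  -- Any positive, strictly decreasing function would serve: strictness turns comparisons of prices
  -- back into comparisons of rates.
  have hp : AntitoneOn (fun c : ℝ => c⁻¹) (Set.Ioi 0) := fun a ha b hb hab =>
    inv_anti₀ ha hab
  have hp0 : ∀ c : ℝ, 0 < c → 0 < c⁻¹ := fun c hc => inv_pos.2 hc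
  obtain ⟨q, hq1, hq2⟩ := hy.exists_price hacc hC hn hp
  have hgap := hy.price_gap hz hq2
  -- Equal rates close the gap, so every nonnegative slackness term vanishes; this gives fullness
  -- and fairness for `z`.
  simp only [h, sub_self, mul_zero, Finset.sum_const_zero] at hgap
  have hu := price_user_nonneg hn hz hq1
  have hl := hy.price_load_nonneg hacc hC hn hz hp0 hq1
  have hu' := Finset.sum_nonneg fun j (_ : j ∈ Finset.univ) =>
    Finset.sum_nonneg fun i (_ : i ∈ Finset.univ) => hu i j
  have hl' := Finset.sum_nonneg fun j (_ : j ∈ Finset.univ) => hl j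
  have hu0 : ∀ i j, n i * ((q j - (totalRate acc y i)⁻¹) * z i j) = 0 := fun i j => by
    have h1 := (Finset.sum_eq_zero_iff_of_nonneg fun j _ =>
      Finset.sum_nonneg fun i _ => hu i j).1 (le_antisymm (by linarith) hu') j (Finset.mem_univ j)
    exact (Finset.sum_eq_zero_iff_of_nonneg fun i _ => hu i j).1 h1 i (Finset.mem_univ i)
  have hl0 := fun j => (Finset.sum_eq_zero_iff_of_nonneg fun j _ => hl j).1
    (le_antisymm (by linarith) hl') j (Finset.mem_univ j)
  have hz0 : ∀ i, n i = 0 → ∀ j, z i j = 0 := fun i hi j => by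
    have h1 : ∑ l, z i l = 0 := by
      rw [← hz.totalRate_eq, h, hy.totalRate_eq_zero hi]
    exact (Finset.sum_eq_zero_iff_of_nonneg fun l _ => hz.apply_nonneg i l).1 h1 j
      (Finset.mem_univ j)
  refine ⟨hz, hz0, fun i hi j hj => ?_, fun i hi j hj k hk => ?_⟩
  · have hqj : 0 < q j := (hp0 _ (hy.totalRate_pos hacc hC hn hi)).trans_le (hq1 i j hi hj)
    have h1 := (mul_eq_zero.1 (hl0 j)).resolve_left hqj.ne'
    rw [hy.full i hi j hj] at h1
    linarith
  · have hkn : n k ≠ 0 := fun h0 => hk.ne' (hz0 k h0 j)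
    have h1 := (mul_eq_zero.1 ((mul_eq_zero.1 (hu0 k j)).resolve_left hkn)).resolve_right hk.ne'
    have h2 := hq1 i j hi hj
    rw [sub_eq_zero.1 h1] at h2
    rw [h]
    exact (inv_le_inv₀ (hy.totalRate_pos hacc hC hn hi)
      (hy.totalRate_pos hacc hC hn ((hn k).lt_of_ne' hkn))).1 h2

/-- A balanced allocation is optimal, and every optimal allocation has the same rates. -/
theorem isOptimalSplit_iff (hy : IsBalanced acc C n y) (hU : IsUtility U)
    (hacc : ∀ i, (acc i).Nonempty) (hC : ∀ j, 0 < C j) (hn : ∀ i, 0 ≤ n i) :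
    IsOptimalSplit acc C n U z ↔
      IsFeasible acc C n z ∧ totalRate acc z = totalRate acc y := by
  set x := totalRate acc y with hx
  set u : ℝ → ℝ := fun c => (U c).toReal with hu
  have hxpos : ∀ i, 0 < n i → 0 < x i := fun i => hy.totalRate_pos hacc hC hn
  have hwy : welfare U n x = ((∑ i, n i * u (x i) : ℝ) : EReal) := by
    have hcoe : ((∑ i, n i * u (x i) : ℝ) : EReal) = ∑ i, ((n i * u (x i) : ℝ) : EReal) :=
      map_sum (⟨⟨Real.toEReal, EReal.coe_zero⟩, EReal.coe_add⟩ : ℝ →+ EReal) _ _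
    rw [hcoe]
    refine Finset.sum_congr rfl fun i _ => ?_
    rcases (hn i).eq_or_lt with h | h
    · simp [← h]
    · rw [EReal.coe_mul, hu, hU.coe_toReal (hxpos i h)]
  have hgap : ∀ w, IsFeasible acc C n w →
      ∑ i, n i * (u (x i) + deriv u (x i) * (totalRate acc w i - x i)) ≤
        ∑ i, n i * u (x i) := by
    intro w hw
    have h1 := hy.sum_price_nonneg hacc hC hn hw hU.deriv_antitoneOn fun c hc => hU.deriv_pos hc
    have h2 : ∑ i, n i * (u (x i) + deriv u (x i) * (totalRate acc w i - x i)) =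
        ∑ i, n i * u (x i) - ∑ i, n i * deriv u (x i) * (x i - totalRate acc w i) := by
      rw [← Finset.sum_sub_distrib]
      exact Finset.sum_congr rfl fun i _ => by ring
    rw [h2]
    linarith
  set g : (I → J → ℝ) → I → ℝ := fun w i =>
    n i * (u (x i) + deriv u (x i) * (totalRate acc w i - x i)) with hg
  have hterm_lt : ∀ w, IsFeasible acc C n w → ∀ i, 0 < n i → totalRate acc w i ≠ x i →
      (n i : EReal) * U (totalRate acc w i) < (g w i : EReal) := by
    intro w hw i hi hne
    have h := hU.lt_tangent (hxpos i hi) (hw.totalRate_nonneg i) hne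
    change U (totalRate acc w i) <
      ((u (x i) + deriv u (x i) * (totalRate acc w i - x i) : ℝ) : EReal) at h
    generalize U (totalRate acc w i) = v at h
    induction v with
    | bot =>
      rw [EReal.coe_mul_bot_of_pos hi]
      exact EReal.bot_lt_coe _
    | coe v =>
      rw [← EReal.coe_mul, EReal.coe_lt_coe_iff]
      exact mul_lt_mul_of_pos_left (EReal.coe_lt_coe_iff.1 h) hi
    | top => exact absurd h not_top_lt
  have hterm : ∀ w, IsFeasible acc C n w → ∀ i,
      (n i : EReal) * U (totalRate acc w i) ≤ (g w i : EReal) := by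
    intro w hw i
    rcases (hn i).eq_or_lt with h | h
    · simp [hg, ← h]
    · by_cases hne : totalRate acc w i = x i
      · simp only [hg, hne, sub_self, mul_zero, add_zero]
        rw [EReal.coe_mul, hu, hU.coe_toReal (hxpos i h)]
      · exact (hterm_lt w hw i h hne).le
  have hcoe : ∀ (s : Finset I) (f : I → ℝ), ((∑ i ∈ s, f i : ℝ) : EReal) = ∑ i ∈ s, (f i : EReal) :=
    fun s f => map_sum (⟨⟨Real.toEReal, EReal.coe_zero⟩, EReal.coe_add⟩ : ℝ →+ EReal) f s
  have hmax : ∀ w, IsFeasible acc C n w → welfare U n (totalRate acc w) ≤ welfare U n x := by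
    intro w hw
    rw [hwy]
    refine le_trans ?_ (EReal.coe_le_coe_iff.2 (hgap w hw))
    rw [hcoe]
    exact Finset.sum_le_sum fun i _ => hterm w hw i
  constructor
  · intro hz
    refine ⟨hz.feasible, funext fun i => ?_⟩
    rcases (hn i).eq_or_lt with h | h
    · rw [hz.inactive i h.symm, hx, hy.totalRate_eq_zero h.symm]
    by_contra hne
    refine absurd (hz.maximal y hy.feasible) (not_le.2 ?_)
    rw [← hx, hwy]
    refine lt_of_lt_of_le ?_ (EReal.coe_le_coe_iff.2 (hgap z hz.feasible))
    change _ < ((∑ i, g z i : ℝ) : EReal)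
    rw [welfare, ← Finset.add_sum_erase _ _ (Finset.mem_univ i),
      ← Finset.add_sum_erase _ _ (Finset.mem_univ i), EReal.coe_add, hcoe]
    -- The other terms are first replaced by their real tangent bounds, since adding `⊥` would
    -- destroy the strict inequality.
    refine lt_of_le_of_lt (add_le_add le_rfl (Finset.sum_le_sum fun k _ =>
      hterm z hz.feasible k)) ?_
    rw [← hcoe]
    exact EReal.add_lt_add_right_coe (hterm_lt z hz.feasible i h hne) _
  · rintro ⟨hz, hzx⟩
    refine ⟨hz, fun i hi => ?_, fun w hw => ?_⟩
    · rw [hzx, hx, hy.totalRate_eq_zero hi]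
    · rw [hzx]
      exact hmax w hw

end IsBalanced

/-- The balanced allocations that use as many pairs of a flow type and a resource as possible. -/
structure IsSaturated (acc : I → Finset J) (C : J → ℝ) (n : I → ℝ) (y : I → J → ℝ) : Prop extends
    IsBalanced acc C n y where
  pos_of_pos : ∀ z, IsFeasible acc C n z → totalRate acc z = totalRate acc y →
    ∀ i j, 0 < z i j → 0 < y i j

/-! ### Allocations of largest support -/

lemma IsFeasible.midpoint (hy : IsFeasible acc C n y) (hz : IsFeasible acc C n z) :
    IsFeasible acc C n ((2 : ℝ)⁻¹ • (y + z)) := by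
  refine ⟨fun i j hj => ?_, fun i j hj => ?_, fun j => ?_⟩
  · have h1 := hy.nonneg i j hj
    have h2 := hz.nonneg i j hj
    simp only [Pi.smul_apply, Pi.add_apply, smul_eq_mul]
    positivity
  · simp [hy.eq_zero i j hj, hz.eq_zero i j hj]
  · have h1 := hy.capacity j
    have h2 := hz.capacity j
    have : ∑ i with j ∈ acc i, n i * ((2 : ℝ)⁻¹ • (y + z)) i j =
        2⁻¹ * (∑ i with j ∈ acc i, n i * y i j + ∑ i with j ∈ acc i, n i * z i j) := by
      rw [← Finset.sum_add_distrib, Finset.mul_sum]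
      refine Finset.sum_congr rfl fun i _ => ?_
      simp only [Pi.smul_apply, Pi.add_apply, smul_eq_mul]
      ring
    rw [this]
    linarith

lemma totalRate_midpoint (acc : I → Finset J) (y z : I → J → ℝ) (i : I) :
    totalRate acc ((2 : ℝ)⁻¹ • (y + z)) i = 2⁻¹ * (totalRate acc y i + totalRate acc z i) := by
  simp [totalRate, ← Finset.mul_sum, Finset.sum_add_distrib]

/-- There are finitely many supports, and the midpoint of two allocations with equal rates has the
union of their supports. A maximal support therefore contains all others. -/
theorem exists_isSaturated (hacc : ∀ i, (acc i).Nonempty) (hC : ∀ j, 0 < C j)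
    (hn : ∀ i, 0 ≤ n i) : ∃ y, IsSaturated acc C n y := by
  classical
  obtain ⟨y₀, hy₀⟩ := exists_isBalanced acc hC hn
  set supp : (I → J → ℝ) → Finset (I × J) := fun y => {p | 0 < y p.1 p.2} with hsupp
  have hfin : (supp '' {y | IsFeasible acc C n y ∧ totalRate acc y = totalRate acc y₀}).Finite :=
    Set.toFinite _
  obtain ⟨y, ⟨hy, hyx⟩, hmax⟩ := Set.Finite.exists_maximalFor' supp
    {y | IsFeasible acc C n y ∧ totalRate acc y = totalRate acc y₀} hfin
    ⟨y₀, hy₀.feasible, rfl⟩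
  refine ⟨y, hy₀.of_totalRate_eq hacc hC hn hy hyx, fun z hz hzy i j hij => ?_⟩
  have hmid := hmax (j := (2 : ℝ)⁻¹ • (y + z)) ⟨hy.midpoint hz, funext fun k => by
    rw [totalRate_midpoint, hzy, hyx]
    ring⟩ (fun p hp => by
      have h1 := hz.apply_nonneg p.1 p.2
      simp only [hsupp, Finset.mem_filter, Finset.mem_univ, true_and, Pi.smul_apply, Pi.add_apply,
        smul_eq_mul] at hp ⊢
      positivity)
  have h1 := hy.apply_nonneg i j
  have : (i, j) ∈ supp y := hmid (by
    simp only [hsupp, Finset.mem_filter, Finset.mem_univ, true_and, Pi.smul_apply, Pi.add_apply,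
      smul_eq_mul]
    positivity)
  simpa [hsupp] using this

variable {s t : ℝ≥0∞} {L : Finset J}

/-! ## Levels of an allocation -/

/-- The level of a resource, which is the smallest rate of the flow types that can use it. -/
noncomputable def resourceLevel (acc : I → Finset J) (n : I → ℝ) (y : I → J → ℝ) (j : J) : ℝ≥0∞ :=
  ⨅ i, ⨅ _ : 0 < n i ∧ j ∈ acc i, ENNReal.ofReal (totalRate acc y i)

/-- The level of a flow type, which is the largest level of the resources that it can use. -/
noncomputable def userLevel (acc : I → Finset J) (n : I → ℝ) (y : I → J → ℝ) (i : I) : ℝ≥0∞ :=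
  (acc i).sup (resourceLevel acc n y)

/-- The network of the flow types and the resources above a given level. -/
noncomputable def levelNetwork (acc : I → Finset J) (n : I → ℝ) (y : I → J → ℝ) (s : ℝ≥0∞) :
    Network I J where
  users := {i | s < userLevel acc n y i}
  resources := {j | s < resourceLevel acc n y j}
  acc i := acc i ∩ ({j | s < resourceLevel acc n y j} : Finset J)

lemma mem_users_levelNetwork {i : I} :
    i ∈ (levelNetwork acc n y s).users ↔ s < userLevel acc n y i := by
  simp [levelNetwork]

lemma mem_resources_levelNetwork {j : J} :
    j ∈ (levelNetwork acc n y s).resources ↔ s < resourceLevel acc n y j := by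
  simp [levelNetwork]

lemma mem_acc_levelNetwork {i : I} {j : J} :
    j ∈ (levelNetwork acc n y s).acc i ↔ j ∈ acc i ∧ s < resourceLevel acc n y j := by
  simp [levelNetwork]

lemma mem_inner_levelNetwork {i : I} :
    i ∈ (levelNetwork acc n y s).inner L ↔
      s < userLevel acc n y i ∧ (levelNetwork acc n y s).acc i ⊆ L := by
  simp [Network.inner, mem_users_levelNetwork]

lemma lt_userLevel_iff {i : I} :
    s < userLevel acc n y i ↔ ∃ j ∈ acc i, s < resourceLevel acc n y j :=
  Finset.lt_sup_iff

lemma resourceLevel_le_userLevel {i : I} {j : J} (hj : j ∈ acc i) :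
    resourceLevel acc n y j ≤ userLevel acc n y i :=
  Finset.le_sup hj

namespace IsBalanced

/-- By fairness every user attains the infimum that defines the level. -/
lemma resourceLevel_eq (hy : IsBalanced acc C n y) (hn : ∀ i, 0 ≤ n i) {i : I} {j : J}
    (h : 0 < y i j) : resourceLevel acc n y j = ENNReal.ofReal (totalRate acc y i) := by
  refine le_antisymm (iInf₂_le i ⟨hy.active_of_pos hn h, hy.feasible.mem_acc h⟩) ?_
  exact le_iInf₂ fun k hk => ENNReal.ofReal_le_ofReal (hy.fair k hk.1 j hk.2 i h)

lemma resourceLevel_ne_top (hy : IsBalanced acc C n y) (hn : ∀ i, 0 ≤ n i) {i : I} {j : J}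
    (h : 0 < y i j) : resourceLevel acc n y j ≠ ⊤ := by
  rw [hy.resourceLevel_eq hn h]
  exact ENNReal.ofReal_ne_top

lemma exists_active {j : J} (hj : resourceLevel acc n y j ≠ ⊤) :
    ∃ i, 0 < n i ∧ j ∈ acc i := by
  by_contra! h
  refine hj ?_
  simp only [resourceLevel, iInf_eq_top]
  exact fun i hi => absurd hi.2 (h i hi.1)

lemma load_eq (hy : IsBalanced acc C n y) {j : J} (hj : resourceLevel acc n y j ≠ ⊤) :
    ∑ i, n i * y i j = C j := by
  obtain ⟨i, hi, hij⟩ := exists_active hj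
  exact hy.full i hi j hij

lemma exists_pos_of_resourceLevel (hy : IsBalanced acc C n y) (hC : ∀ j, 0 < C j)
    (hn : ∀ i, 0 ≤ n i) {j : J} (hj : resourceLevel acc n y j ≠ ⊤) : ∃ i, 0 < y i j := by
  obtain ⟨i, hi, hij⟩ := exists_active hj
  exact hy.exists_pos hC hn hi hij

lemma resourceLevel_pos (hy : IsBalanced acc C n y) (hC : ∀ j, 0 < C j)
    (hn : ∀ i, 0 ≤ n i) (j : J) : 0 < resourceLevel acc n y j := by
  by_cases hj : resourceLevel acc n y j = ⊤
  · simp [hj]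
  · obtain ⟨i, hi⟩ := hy.exists_pos_of_resourceLevel hC hn hj
    rw [hy.resourceLevel_eq hn hi, ENNReal.ofReal_pos]
    exact hi.trans_le (hy.le_totalRate i j)

lemma exists_pos_of_active (hy : IsBalanced acc C n y) (hacc : ∀ i, (acc i).Nonempty)
    (hC : ∀ j, 0 < C j) (hn : ∀ i, 0 ≤ n i) {i : I} (hi : 0 < n i) : ∃ j, 0 < y i j := by
  by_contra! h
  have h1 := hy.totalRate_pos hacc hC hn hi
  rw [hy.feasible.totalRate_eq] at h1
  exact h1.not_ge (Finset.sum_nonpos fun j _ => h j)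

/-- An active type bounds the levels of all its resources by its own rate and attains this bound
where it is served. For an inactive type the level only tells when its last resource disappears. -/
lemma userLevel_eq (hy : IsBalanced acc C n y) (hacc : ∀ i, (acc i).Nonempty)
    (hC : ∀ j, 0 < C j) (hn : ∀ i, 0 ≤ n i) {i : I} (hi : 0 < n i) :
    userLevel acc n y i = ENNReal.ofReal (totalRate acc y i) := by
  refine le_antisymm (Finset.sup_le fun j hj => iInf₂_le i ⟨hi, hj⟩) ?_
  obtain ⟨j, hj⟩ := hy.exists_pos_of_active hacc hC hn hi
  rw [← hy.resourceLevel_eq hn hj]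
  exact resourceLevel_le_userLevel (hy.feasible.mem_acc hj)

lemma userLevel_eq_resourceLevel (hy : IsBalanced acc C n y) (hacc : ∀ i, (acc i).Nonempty)
    (hC : ∀ j, 0 < C j) (hn : ∀ i, 0 ≤ n i) {i : I} {j : J} (h : 0 < y i j) :
    userLevel acc n y i = resourceLevel acc n y j := by
  rw [hy.userLevel_eq hacc hC hn (hy.active_of_pos hn h), hy.resourceLevel_eq hn h]

end IsBalanced

/-- `t` is the smallest level of a resource above `s`. -/
structure IsNextLevel (acc : I → Finset J) (n : I → ℝ) (y : I → J → ℝ) (s t : ℝ≥0∞) : Prop where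
  lt : s < t
  le_of_lt : ∀ j, s < resourceLevel acc n y j → t ≤ resourceLevel acc n y j
  exists_eq : ∃ j, resourceLevel acc n y j = t

/-- A set of resources of level `t` whose capacity is used up by flow types which, above level
`s`, have no other resources. -/
structure IsTight (acc : I → Finset J) (n : I → ℝ) (y : I → J → ℝ) (s t : ℝ≥0∞)
    (L : Finset J) : Prop where
  nonempty : L.Nonempty
  level_eq : ∀ j ∈ L, resourceLevel acc n y j = t
  acc_subset : ∀ j ∈ L, ∀ i, 0 < y i j → (levelNetwork acc n y s).acc i ⊆ L

/-! ### Rates of sets of resources above a level -/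

namespace IsNextLevel

lemma le_userLevel (ht : IsNextLevel acc n y s t) {i : I} (hi : s < userLevel acc n y i) :
    t ≤ userLevel acc n y i := by
  obtain ⟨j, hj, hs⟩ := lt_userLevel_iff.1 hi
  exact (ht.le_of_lt j hs).trans (resourceLevel_le_userLevel hj)

lemma userLevel_eq (ht : IsNextLevel acc n y s t) (hL : ∀ j ∈ L, resourceLevel acc n y j = t)
    {i : I} (hi : i ∈ (levelNetwork acc n y s).inner L) : userLevel acc n y i = t := by
  obtain ⟨hs, hsub⟩ := mem_inner_levelNetwork.1 hi
  refine le_antisymm (Finset.sup_le fun j hj => ?_) (ht.le_userLevel hs)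
  by_cases h : s < resourceLevel acc n y j
  · exact (hL j (hsub (mem_acc_levelNetwork.2 ⟨hj, h⟩))).le
  · exact (not_lt.1 h).trans ht.lt.le

lemma subset_resources (ht : IsNextLevel acc n y s t) (hL : IsTight acc n y s t L) :
    L ⊆ (levelNetwork acc n y s).resources := fun j hj => by
  rw [mem_resources_levelNetwork, hL.level_eq j hj]
  exact ht.lt

lemma mem_inner (ht : IsNextLevel acc n y s t) (hy : IsBalanced acc C n y)
    (hacc : ∀ i, (acc i).Nonempty) (hC : ∀ j, 0 < C j) (hn : ∀ i, 0 ≤ n i)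
    (hL : IsTight acc n y s t L) {i : I} {j : J} (hj : j ∈ L) (hij : 0 < y i j) :
    i ∈ (levelNetwork acc n y s).inner L := by
  refine mem_inner_levelNetwork.2 ⟨?_, hL.acc_subset j hj i hij⟩
  rw [hy.userLevel_eq_resourceLevel hacc hC hn hij, hL.level_eq j hj]
  exact ht.lt

/-- What is missing for the equality of `t` and the rate of `L`. -/
lemma capacity_sub_eq (hy : IsBalanced acc C n y) (hacc : ∀ i, (acc i).Nonempty)
    (hC : ∀ j, 0 < C j) (hn : ∀ i, 0 ≤ n i) (τ : ℝ) (L : Finset J) :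
    ∑ j ∈ L, C j - τ * ∑ i ∈ (levelNetwork acc n y s).inner L, n i =
      ∑ i ∈ (levelNetwork acc n y s).inner L, n i * (totalRate acc y i - τ) +
      ∑ j ∈ L, (C j - ∑ i ∈ (levelNetwork acc n y s).inner L, n i * y i j) := by
  have h : ∀ i ∈ (levelNetwork acc n y s).inner L, n i * totalRate acc y i =
      ∑ j ∈ L, n i * y i j := by
    intro i hi
    obtain ⟨hs, hsub⟩ := mem_inner_levelNetwork.1 hi
    rw [hy.feasible.totalRate_eq, ← Finset.mul_sum]
    congr 1
    refine (Finset.sum_subset (Finset.subset_univ L) fun j _ hj => ?_).symm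
    by_contra hne
    have hpos := (hy.feasible.apply_nonneg i j).lt_of_ne' hne
    -- A type is served only at its own level, which is above `s`; hence types confined to `L` get
    -- all their rate inside `L`.
    refine hj (hsub (mem_acc_levelNetwork.2 ⟨hy.feasible.mem_acc hpos, ?_⟩))
    rwa [← hy.userLevel_eq_resourceLevel hacc hC hn hpos]
  simp only [mul_sub, Finset.sum_sub_distrib, Finset.sum_congr rfl h]
  rw [Finset.sum_comm (s := L), Finset.mul_sum]
  simp only [mul_comm τ]
  ring

lemma sum_inner_le (hy : IsBalanced acc C n y) (hn : ∀ i, 0 ≤ n i) (A : Finset I) (j : J) :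
    ∑ i ∈ A, n i * y i j ≤ C j :=
  (Finset.sum_le_sum_of_subset_of_nonneg (Finset.subset_univ A) fun k _ _ =>
    mul_nonneg (hn k) (hy.feasible.apply_nonneg k j)).trans (hy.feasible.load_le j)

/-- For finite `t` both sums in `capacity_sub_eq` are nonnegative, because active types left above
`s` have rate at least `t` and loads respect capacities. Equality holds when all their terms vanish,
which is tightness. -/
lemma rate_spec (ht : IsNextLevel acc n y s t) (hy : IsBalanced acc C n y)
    (hacc : ∀ i, (acc i).Nonempty) (hC : ∀ j, 0 < C j) (hn : ∀ i, 0 ≤ n i)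
    (hL : L ⊆ (levelNetwork acc n y s).resources) (hne : L.Nonempty) :
    t ≤ rate C n ((levelNetwork acc n y s).inner L) L ∧
      (rate C n ((levelNetwork acc n y s).inner L) L = t ↔ IsTight acc n y s t L) := by
  set A := (levelNetwork acc n y s).inner L with hA
  have hCpos : 0 < ∑ j ∈ L, C j := Finset.sum_pos (fun j _ => hC j) hne
  have hlevel : ∀ j ∈ L, t ≤ resourceLevel acc n y j := fun j hj =>
    ht.le_of_lt j (mem_resources_levelNetwork.1 (hL hj))
  have hBnn : 0 ≤ ∑ i ∈ A, n i := Finset.sum_nonneg fun i _ => hn i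
  rcases hBnn.eq_or_lt with hB | hB
  -- Without flows in `A` the rate is `⊤`. It equals `t` only at level `⊤`, where no resource has
  -- users and tightness is automatic.
  · have htop : rate C n A L = ⊤ := by
      rw [rate, ← hB, ENNReal.ofReal_zero, ENNReal.div_zero]
      exact (ENNReal.ofReal_pos.2 hCpos).ne'
    rw [htop]
    refine ⟨le_top, fun h => ⟨hne, fun j hj => ?_, fun j hj i hij => ?_⟩, fun h => ?_⟩
    · exact le_antisymm (h ▸ le_top) (hlevel j hj)
    · exact absurd (top_le_iff.1 (h ▸ hlevel j hj)) (hy.resourceLevel_ne_top hn hij)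
    · by_contra hnt
      obtain ⟨j, hj⟩ := hne
      have hjt : resourceLevel acc n y j ≠ ⊤ := by
        rw [h.level_eq j hj]
        exact fun h => hnt h.symm
      obtain ⟨i, hij⟩ := hy.exists_pos_of_resourceLevel hC hn hjt
      have hi : i ∈ A := ht.mem_inner hy hacc hC hn h hj hij
      have := (Finset.sum_eq_zero_iff_of_nonneg fun i _ => hn i).1 hB.symm i hi
      exact (hy.active_of_pos hn hij).ne' this
  · have hle : ∀ i ∈ A, 0 < n i → t ≤ ENNReal.ofReal (totalRate acc y i) := by
      intro i hi hni
      rw [← hy.userLevel_eq hacc hC hn hni]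
      exact ht.le_userLevel (mem_inner_levelNetwork.1 hi).1
    have htop : t ≠ ⊤ := by
      obtain ⟨i, hi, hni⟩ : ∃ i ∈ A, 0 < n i := by
        by_contra! h
        exact hB.not_ge (Finset.sum_nonpos h)
      exact ne_top_of_le_ne_top ENNReal.ofReal_ne_top (hle i hi hni)
    obtain ⟨τ, hτ, rfl⟩ : ∃ τ : ℝ, 0 ≤ τ ∧ ENNReal.ofReal τ = t :=
      ⟨t.toReal, ENNReal.toReal_nonneg, ENNReal.ofReal_toReal htop⟩
    have hrate : rate C n A L = ENNReal.ofReal ((∑ j ∈ L, C j) / ∑ i ∈ A, n i) := by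
      rw [rate, ENNReal.ofReal_div_of_pos hB]
    have hgap := capacity_sub_eq (s := s) hy hacc hC hn τ L
    rw [← hA] at hgap
    have h1 : ∀ i ∈ A, 0 ≤ n i * (totalRate acc y i - τ) := by
      intro i hi
      rcases (hn i).eq_or_lt with h | h
      · simp [← h]
      · exact mul_nonneg h.le (sub_nonneg.2 ((ENNReal.ofReal_le_ofReal_iff
          (hy.feasible.totalRate_nonneg i)).1 (hle i hi h)))
    have h2 : ∀ j ∈ L, 0 ≤ C j - ∑ i ∈ A, n i * y i j := fun j _ =>
      sub_nonneg.2 (sum_inner_le hy hn A j)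
    have h1' := Finset.sum_nonneg h1
    have h2' := Finset.sum_nonneg h2
    have hquot : 0 ≤ (∑ j ∈ L, C j) / ∑ i ∈ A, n i := div_nonneg hCpos.le hBnn
    refine ⟨?_, ?_⟩
    · rw [hrate, ENNReal.ofReal_le_ofReal_iff hquot, le_div_iff₀ hB]
      linarith
    · rw [hrate, ENNReal.ofReal_eq_ofReal_iff hquot hτ, div_eq_iff hB.ne']
      constructor
      · intro heq
        have h10 := (Finset.sum_eq_zero_iff_of_nonneg h1).1 (by linarith)
        have h20 := (Finset.sum_eq_zero_iff_of_nonneg h2).1 (by linarith)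
        -- The types in `A` already fill `j`, so a further user would exceed its capacity.
        have hcov : ∀ j ∈ L, ∀ k, 0 < y k j → k ∈ A := by
          intro j hj k hk
          by_contra hkA
          have h3 := sum_inner_le hy hn (insert k A) j
          rw [Finset.sum_insert hkA] at h3
          have := mul_pos (hy.active_of_pos hn hk) hk
          linarith [h20 j hj]
        refine ⟨hne, fun j hj => ?_, fun j hj i hij =>
          (mem_inner_levelNetwork.1 (hcov j hj i hij)).2⟩
        obtain ⟨i, hi, hij⟩ : ∃ i ∈ A, 0 < y i j := by
          by_contra! h
          have : ∑ i ∈ A, n i * y i j ≤ 0 :=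
            Finset.sum_nonpos fun k hk => mul_nonpos_of_nonneg_of_nonpos (hn k) (h k hk)
          linarith [h20 j hj, hC j]
        have := (mul_eq_zero.1 (h10 i hi)).resolve_left (hy.active_of_pos hn hij).ne'
        rw [hy.resourceLevel_eq hn hij, sub_eq_zero.1 this]
      · intro hT
        have h10 : ∀ i ∈ A, n i * (totalRate acc y i - τ) = 0 := by
          intro i hi
          rcases (hn i).eq_or_lt with h | h
          · simp [← h]
          · have h3 := ht.userLevel_eq hT.level_eq hi
            rw [hy.userLevel_eq hacc hC hn h, ENNReal.ofReal_eq_ofReal_iff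
              (hy.feasible.totalRate_nonneg i) hτ] at h3
            rw [h3, sub_self, mul_zero]
        have h20 : ∀ j ∈ L, C j - ∑ i ∈ A, n i * y i j = 0 := by
          intro j hj
          rw [← hy.load_eq (j := j) (by rw [hT.level_eq j hj]; exact ENNReal.ofReal_ne_top),
            sub_eq_zero]
          refine (Finset.sum_subset (Finset.subset_univ A) fun k _ hk => ?_).symm
          by_contra h0
          refine hk (ht.mem_inner hy hacc hC hn hT hj ?_)
          exact (hy.feasible.apply_nonneg k j).lt_of_ne' fun h => h0 (by rw [h, mul_zero])
        rw [Finset.sum_eq_zero h10, Finset.sum_eq_zero h20] at hgap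
        linarith

end IsNextLevel

lemma mem_strong_levelNetwork :
    L ∈ (levelNetwork acc n y s).strong ↔ L ⊆ (levelNetwork acc n y s).resources ∧
      (levelNetwork acc n y s).IsConnected ((levelNetwork acc n y s).inner L) L := by
  simp [Network.strong]

/-- Every resource of a tight set lies in a strongly connected tight subset. -/
lemma IsTight.exists_strong (ht : IsNextLevel acc n y s t) (hy : IsBalanced acc C n y)
    (hacc : ∀ i, (acc i).Nonempty) (hC : ∀ j, 0 < C j) (hn : ∀ i, 0 ≤ n i) {j : J}
    (hL : IsTight acc n y s t L) (hj : j ∈ L) :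
    ∃ L' ⊆ L, j ∈ L' ∧ L' ∈ (levelNetwork acc n y s).strong ∧ IsTight acc n y s t L' := by
  induction L using Finset.strongInduction with
  | H L ih =>
  by_cases hc : (levelNetwork acc n y s).IsConnected ((levelNetwork acc n y s).inner L) L
  · exact ⟨L, subset_rfl, hj, mem_strong_levelNetwork.2 ⟨ht.subset_resources hL, hc⟩, hL⟩
  · have hc' := fun h => hc ⟨hL.nonempty, h⟩
    obtain ⟨J₁, J₂, hJ₁, hJ₂, hdisj, hun, I₁, I₂, -, hI, h₁, h₂⟩ := not_not.1 hc'
    -- The side containing `j` is again tight: its users are confined to `L`, cannot be in `Q`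
    -- because they use `A`, and so cannot reach `B`. The statement is symmetric in the two sides.
    have part : ∀ A B : Finset J, A.Nonempty → B.Nonempty → Disjoint A B → A ∪ B = L →
        ∀ P Q : Finset I, P ∪ Q = (levelNetwork acc n y s).inner L →
        (∀ i ∈ P, Disjoint ((levelNetwork acc n y s).acc i) B) →
        (∀ i ∈ Q, Disjoint ((levelNetwork acc n y s).acc i) A) → j ∈ A →
        ∃ L' ⊆ L, j ∈ L' ∧ L' ∈ (levelNetwork acc n y s).strong ∧ IsTight acc n y s t L' := by
      intro A B hAne hBne hAB hABL P Q hPQ hP hQ hjA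
      have hAL : A ⊆ L := hABL ▸ Finset.subset_union_left
      have hA : IsTight acc n y s t A := by
        refine ⟨hAne, fun l hl => hL.level_eq l (hAL hl), fun l hl i hil => ?_⟩
        have hi := ht.mem_inner hy hacc hC hn hL (hAL hl) hil
        have hlacc : l ∈ (levelNetwork acc n y s).acc i :=
          mem_acc_levelNetwork.2 ⟨hy.feasible.mem_acc hil,
            by rw [hL.level_eq l (hAL hl)]; exact ht.lt⟩
        have hiP : i ∈ P := by
          rw [← hPQ, Finset.mem_union] at hi
          exact hi.resolve_right fun h => Finset.disjoint_left.1 (hQ i h) hlacc hl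
        intro m hm
        have hmL := (mem_inner_levelNetwork.1 hi).2 hm
        rw [← hABL, Finset.mem_union] at hmL
        exact hmL.resolve_right (Finset.disjoint_left.1 (hP i hiP) hm)
      have hss : A ⊂ L := by
        refine Finset.ssubset_iff_subset_ne.2 ⟨hAL, ?_⟩
        rintro rfl
        obtain ⟨b, hb⟩ := hBne
        exact Finset.disjoint_left.1 hAB (hABL ▸ Finset.mem_union_right _ hb) hb
      obtain ⟨L', h1, h2⟩ := ih A hss hA hjA
      exact ⟨L', h1.trans hAL, h2⟩
    rcases Finset.mem_union.1 (hun.symm ▸ hj) with h | h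
    · exact part J₁ J₂ hJ₁ hJ₂ hdisj hun I₁ I₂ hI h₁ h₂ h
    · exact part J₂ J₁ hJ₂ hJ₁ hdisj.symm ((Finset.union_comm _ _).trans hun) I₂ I₁
        ((Finset.union_comm _ _).trans hI) h₂ h₁ h

/-! ### Minimisers at one level and the reduced network -/

namespace IsNextLevel

/-- The resources of level `t` form a tight set. -/
lemma isTight_level (ht : IsNextLevel acc n y s t) (hy : IsBalanced acc C n y)
    (hacc : ∀ i, (acc i).Nonempty) (hC : ∀ j, 0 < C j) (hn : ∀ i, 0 ≤ n i) :
    IsTight acc n y s t {j | resourceLevel acc n y j = t} := by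
  obtain ⟨j₀, hj₀⟩ := ht.exists_eq
  refine ⟨⟨j₀, by simpa using hj₀⟩, fun j hj => by simpa using hj, fun j hj i hij l hl => ?_⟩
  obtain ⟨hl, hs⟩ := mem_acc_levelNetwork.1 hl
  simp only [Finset.mem_filter, Finset.mem_univ, true_and] at hj ⊢
  refine le_antisymm ?_ (ht.le_of_lt l hs)
  rw [← hj, ← hy.userLevel_eq_resourceLevel hacc hC hn hij]
  exact resourceLevel_le_userLevel hl

lemma minRate_eq (ht : IsNextLevel acc n y s t) (hy : IsBalanced acc C n y)
    (hacc : ∀ i, (acc i).Nonempty) (hC : ∀ j, 0 < C j) (hn : ∀ i, 0 ≤ n i) :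
    (levelNetwork acc n y s).minRate C n = t := by
  refine le_antisymm ?_ (Finset.le_inf fun L hL => ?_)
  · obtain ⟨j, hj⟩ := ht.exists_eq
    obtain ⟨L, -, -, hs, hL⟩ := (ht.isTight_level hy hacc hC hn).exists_strong ht hy hacc hC hn
      (j := j) (by simpa using hj)
    rw [← (ht.rate_spec hy hacc hC hn (ht.subset_resources hL) hL.nonempty).2.2 hL]
    exact Finset.inf_le hs
  · obtain ⟨h1, h2⟩ := mem_strong_levelNetwork.1 hL
    exact (ht.rate_spec hy hacc hC hn h1 h2.1).1

lemma mem_minimisers (ht : IsNextLevel acc n y s t) (hy : IsBalanced acc C n y)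
    (hacc : ∀ i, (acc i).Nonempty) (hC : ∀ j, 0 < C j) (hn : ∀ i, 0 ≤ n i) :
    L ∈ (levelNetwork acc n y s).minimisers C n ↔
      L ∈ (levelNetwork acc n y s).strong ∧ IsTight acc n y s t L := by
  rw [Network.minimisers, Finset.mem_filter, ht.minRate_eq hy hacc hC hn]
  refine and_congr_right fun hL => ?_
  obtain ⟨h1, h2⟩ := mem_strong_levelNetwork.1 hL
  exact (ht.rate_spec hy hacc hC hn h1 h2.1).2

lemma mem_levelResources (ht : IsNextLevel acc n y s t) (hy : IsBalanced acc C n y)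
    (hacc : ∀ i, (acc i).Nonempty) (hC : ∀ j, 0 < C j) (hn : ∀ i, 0 ≤ n i) {j : J} :
    j ∈ (levelNetwork acc n y s).levelResources C n ↔ resourceLevel acc n y j = t := by
  simp only [Network.levelResources, Finset.mem_biUnion, ht.mem_minimisers hy hacc hC hn, id]
  constructor
  · rintro ⟨L, ⟨-, hL⟩, hj⟩
    exact hL.level_eq j hj
  · intro hj
    obtain ⟨L, -, hjL, hs, hL⟩ := (ht.isTight_level hy hacc hC hn).exists_strong ht hy hacc hC hn
      (j := j) (by simpa using hj)
    exact ⟨L, ⟨hs, hL⟩, hjL⟩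

lemma mem_levelUsers (ht : IsNextLevel acc n y s t) (hy : IsBalanced acc C n y)
    (hacc : ∀ i, (acc i).Nonempty) (hC : ∀ j, 0 < C j) (hn : ∀ i, 0 ≤ n i) {i : I} :
    i ∈ (levelNetwork acc n y s).levelUsers C n ↔ userLevel acc n y i = t := by
  constructor
  · exact ht.userLevel_eq fun j hj => (ht.mem_levelResources hy hacc hC hn).1 hj
  · intro hi
    refine mem_inner_levelNetwork.2 ⟨hi ▸ ht.lt, fun j hj => ?_⟩
    obtain ⟨hj, hs⟩ := mem_acc_levelNetwork.1 hj
    exact (ht.mem_levelResources hy hacc hC hn).2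
      (le_antisymm (hi ▸ resourceLevel_le_userLevel hj) (ht.le_of_lt j hs))

/-- A step removes exactly level `t`, and nothing lies strictly between `s` and `t`. -/
lemma next_eq (ht : IsNextLevel acc n y s t) (hy : IsBalanced acc C n y)
    (hacc : ∀ i, (acc i).Nonempty) (hC : ∀ j, 0 < C j) (hn : ∀ i, 0 ≤ n i) :
    (levelNetwork acc n y s).next C n = levelNetwork acc n y t := by
  have hr : (levelNetwork acc n y s).resources \ (levelNetwork acc n y s).levelResources C n =
      ({j | t < resourceLevel acc n y j} : Finset J) := by
    ext j
    rw [Finset.mem_sdiff, ht.mem_levelResources hy hacc hC hn, mem_resources_levelNetwork,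
      Finset.mem_filter]
    simp only [Finset.mem_univ, true_and]
    exact ⟨fun h => (ht.le_of_lt j h.1).lt_of_ne' h.2, fun h => ⟨ht.lt.trans h, h.ne'⟩⟩
  have hu : (levelNetwork acc n y s).users \ (levelNetwork acc n y s).levelUsers C n =
      ({i | t < userLevel acc n y i} : Finset I) := by
    ext i
    rw [Finset.mem_sdiff, ht.mem_levelUsers hy hacc hC hn, mem_users_levelNetwork,
      Finset.mem_filter]
    simp only [Finset.mem_univ, true_and]
    exact ⟨fun h => (ht.le_userLevel h.1).lt_of_ne' h.2, fun h => ⟨ht.lt.trans h, h.ne'⟩⟩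
  rw [Network.next, hr, hu]
  simp only [levelNetwork, Network.mk.injEq, true_and]
  funext i
  ext j
  simp only [Finset.mem_inter, Finset.mem_filter, Finset.mem_univ, true_and]
  exact ⟨fun h => ⟨h.1.1, h.2⟩, fun h => ⟨⟨h.1, ht.lt.trans h.2⟩, h.2⟩⟩

end IsNextLevel

/-! ## Components of the support of an allocation -/

lemma supportGraph_adj_inl_inr {i : I} {j : J} :
    (supportGraph y).Adj (Sum.inl i) (Sum.inr j) ↔ 0 < y i j := by
  simp [supportGraph]

lemma supportGraph_adj_inr_inl {i : I} {j : J} :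
    (supportGraph y).Adj (Sum.inr j) (Sum.inl i) ↔ 0 < y i j := by
  simp [supportGraph]

/-- A property of vertices that passes along edges passes along paths. -/
lemma of_reachable_supportGraph {P : I ⊕ J → Prop}
    (h1 : ∀ i j, 0 < y i j → P (Sum.inl i) → P (Sum.inr j))
    (h2 : ∀ i j, 0 < y i j → P (Sum.inr j) → P (Sum.inl i)) {v w : I ⊕ J}
    (h : (supportGraph y).Reachable v w) (hv : P v) : P w := by
  obtain ⟨p⟩ := h
  induction p with
  | nil => exact hv
  | cons hadj _ ih =>
    refine ih ?_
    rcases hadj with ⟨i, j, rfl, rfl, h⟩ | ⟨i, j, rfl, rfl, h⟩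
    · exact h1 i j h hv
    · exact h2 i j h hv

open scoped Classical in
/-- The flow types that have flows and are joined to the resource `j` in the support of `y`. -/
noncomputable def componentUsers (n : I → ℝ) (y : I → J → ℝ) (j : J) : Finset I :=
  {i | 0 < n i ∧ (supportGraph y).Reachable (Sum.inr j) (Sum.inl i)}

open scoped Classical in
/-- The resources that are joined to the resource `j` in the support of `y`. -/
noncomputable def componentResources (y : I → J → ℝ) (j : J) : Finset J :=
  {l | (supportGraph y).Reachable (Sum.inr j) (Sum.inr l)}

lemma mem_componentUsers {i : I} {j : J} : i ∈ componentUsers n y j ↔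
    0 < n i ∧ (supportGraph y).Reachable (Sum.inr j) (Sum.inl i) := by
  simp [componentUsers]

lemma mem_componentResources {j l : J} : l ∈ componentResources y j ↔
    (supportGraph y).Reachable (Sum.inr j) (Sum.inr l) := by
  simp [componentResources]

lemma self_mem_componentResources (y : I → J → ℝ) (j : J) : j ∈ componentResources y j :=
  mem_componentResources.2 (SimpleGraph.Reachable.refl _)

lemma componentResources_eq {j l : J} (h : l ∈ componentResources y j) :
    componentResources y l = componentResources y j := by
  rw [mem_componentResources] at h
  ext m
  rw [mem_componentResources, mem_componentResources]
  exact ⟨fun h' => h.trans h', fun h' => h.symm.trans h'⟩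

lemma mem_active {A : Finset I} {i : I} : i ∈ active n A ↔ i ∈ A ∧ 0 < n i := by
  simp [active]

namespace IsBalanced

lemma level_eq_of_reachable (hy : IsBalanced acc C n y) (hacc : ∀ i, (acc i).Nonempty)
    (hC : ∀ j, 0 < C j) (hn : ∀ i, 0 ≤ n i) {v w : I ⊕ J}
    (h : (supportGraph y).Reachable v w) :
    Sum.elim (userLevel acc n y) (resourceLevel acc n y) v =
      Sum.elim (userLevel acc n y) (resourceLevel acc n y) w :=
  of_reachable_supportGraph
    (P := fun w => Sum.elim (userLevel acc n y) (resourceLevel acc n y) v =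
      Sum.elim (userLevel acc n y) (resourceLevel acc n y) w)
    (fun _ _ hij hv => hv.trans (hy.userLevel_eq_resourceLevel hacc hC hn hij))
    (fun _ _ hij hv => hv.trans (hy.userLevel_eq_resourceLevel hacc hC hn hij).symm) h rfl

lemma resourceLevel_eq_of_mem (hy : IsBalanced acc C n y) (hacc : ∀ i, (acc i).Nonempty)
    (hC : ∀ j, 0 < C j) (hn : ∀ i, 0 ≤ n i) {j l : J} (h : l ∈ componentResources y j) :
    resourceLevel acc n y l = resourceLevel acc n y j :=
  (hy.level_eq_of_reachable hacc hC hn (mem_componentResources.1 h)).symm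

/-- Every active type is served somewhere, so each cluster contains a resource, which can index it.
-/
lemma isCluster_iff (hy : IsBalanced acc C n y) (hacc : ∀ i, (acc i).Nonempty)
    (hC : ∀ j, 0 < C j) (hn : ∀ i, 0 ≤ n i)
    (hJ : ∀ v w, Joined acc C n U v w ↔ (supportGraph y).Reachable v w)
    {I' : Finset I} {J' : Finset J} :
    IsCluster acc C n U I' J' ↔
      ∃ j, I' = componentUsers n y j ∧ J' = componentResources y j := by
  constructor
  · intro h
    obtain ⟨j, hj⟩ : J'.Nonempty := by
      rcases h.nonempty with ⟨i, hi⟩ | hne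
      · obtain ⟨j, hij⟩ := hy.exists_pos_of_active hacc hC hn (h.active i hi)
        refine ⟨j, (h.mem_resources_iff (Sum.inl i) (by simpa using hi) j).2 ((hJ _ _).2 ?_)⟩
        exact (supportGraph_adj_inl_inr.2 hij).reachable
      · exact hne
    have hv : Sum.inr j ∈ I'.disjSum J' := by simpa using hj
    refine ⟨j, ?_, ?_⟩
    · ext i
      rw [mem_componentUsers]
      exact ⟨fun hi => ⟨h.active i hi, (hJ _ _).1
        ((h.mem_users_iff _ hv i (h.active i hi)).1 hi)⟩,
        fun hi => (h.mem_users_iff _ hv i hi.1).2 ((hJ _ _).2 hi.2)⟩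
    · ext l
      rw [mem_componentResources, h.mem_resources_iff _ hv, hJ]
  · rintro ⟨j, rfl, rfl⟩
    have hv : ∀ v ∈ (componentUsers n y j).disjSum (componentResources y j),
        (supportGraph y).Reachable (Sum.inr j) v := by
      rintro (i | l) h
      · rw [Finset.inl_mem_disjSum] at h
        exact (mem_componentUsers.1 h).2
      · rw [Finset.inr_mem_disjSum] at h
        exact mem_componentResources.1 h
    refine ⟨Or.inr ⟨j, self_mem_componentResources y j⟩, fun i hi => (mem_componentUsers.1 hi).1,
      fun v hv' i hi => ?_, fun v hv' l => ?_⟩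
    · rw [mem_componentUsers, hJ]
      exact ⟨fun h => (hv v hv').symm.trans h.2, fun h => ⟨hi, (hv v hv').trans h⟩⟩
    · rw [mem_componentResources, hJ]
      exact ⟨fun h => (hv v hv').symm.trans h, fun h => (hv v hv').trans h⟩

lemma componentUsers_eq_empty_iff (hy : IsBalanced acc C n y) (hacc : ∀ i, (acc i).Nonempty)
    (hC : ∀ j, 0 < C j) (hn : ∀ i, 0 ≤ n i) {j : J} :
    componentUsers n y j = ∅ ↔ resourceLevel acc n y j = ⊤ := by
  constructor
  · intro h
    by_contra hj
    obtain ⟨i, hij⟩ := hy.exists_pos_of_resourceLevel hC hn hj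
    have : i ∈ componentUsers n y j := mem_componentUsers.2
      ⟨hy.active_of_pos hn hij, (supportGraph_adj_inr_inl.2 hij).reachable⟩
    simp [h] at this
  · intro h
    by_contra hne
    obtain ⟨i, hi⟩ := Finset.nonempty_iff_ne_empty.2 hne
    obtain ⟨hi, hr⟩ := mem_componentUsers.1 hi
    have := hy.level_eq_of_reachable hacc hC hn hr
    simp only [Sum.elim_inr, Sum.elim_inl, h, hy.userLevel_eq hacc hC hn hi] at this
    exact ENNReal.ofReal_ne_top this.symm

lemma isClusterAtLevel_iff (hy : IsBalanced acc C n y) (hacc : ∀ i, (acc i).Nonempty)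
    (hC : ∀ j, 0 < C j) (hn : ∀ i, 0 ≤ n i)
    (hJ : ∀ v w, Joined acc C n U v w ↔ (supportGraph y).Reachable v w)
    {I' : Finset I} {J' : Finset J} {ρ : ℝ≥0∞} :
    IsClusterAtLevel acc C n U (totalRate acc y) ρ I' J' ↔
      ∃ j, resourceLevel acc n y j = ρ ∧ I' = componentUsers n y j ∧
        J' = componentResources y j := by
  have hrate : ∀ j, ∀ i ∈ componentUsers n y j,
      ENNReal.ofReal (totalRate acc y i) = resourceLevel acc n y j := by
    intro j i hi
    obtain ⟨hi, hr⟩ := mem_componentUsers.1 hi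
    rw [← hy.userLevel_eq hacc hC hn hi]
    exact (hy.level_eq_of_reachable hacc hC hn hr).symm
  constructor
  · intro h
    obtain ⟨j, rfl, rfl⟩ := (hy.isCluster_iff hacc hC hn hJ).1 h.isCluster
    refine ⟨j, ?_, rfl, rfl⟩
    by_cases hj : componentUsers n y j = ∅
    · rw [h.rate_empty hj, ← hy.componentUsers_eq_empty_iff hacc hC hn, hj]
    · obtain ⟨i, hi⟩ := Finset.nonempty_iff_ne_empty.2 hj
      rw [← h.rate_eq i hi, hrate j i hi]
  · rintro ⟨j, rfl, rfl, rfl⟩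
    exact ⟨(hy.isCluster_iff hacc hC hn hJ).2 ⟨j, rfl, rfl⟩, hrate j,
      (hy.componentUsers_eq_empty_iff hacc hC hn).1⟩

end IsBalanced

namespace IsTight

/-- Paths cannot leave a tight set: users of its resources are confined to it, and a confined type
is served only inside. -/
lemma component_subset (hL : IsTight acc n y s t L) (ht : IsNextLevel acc n y s t)
    (hy : IsBalanced acc C n y) (hacc : ∀ i, (acc i).Nonempty) (hC : ∀ j, 0 < C j)
    (hn : ∀ i, 0 ≤ n i) {j : J} (hj : j ∈ L) :
    componentResources y j ⊆ L ∧ componentUsers n y j ⊆ (levelNetwork acc n y s).inner L := by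
  have key : ∀ v, (supportGraph y).Reachable (Sum.inr j) v →
      Sum.elim (· ∈ (levelNetwork acc n y s).inner L) (· ∈ L) v := fun v hv => by
    refine of_reachable_supportGraph
      (P := Sum.elim (· ∈ (levelNetwork acc n y s).inner L) (· ∈ L))
      (fun i l hil hi => ?_) (fun i l hil hl => ht.mem_inner hy hacc hC hn hL hl hil) hv hj
    obtain ⟨hs, hsub⟩ := mem_inner_levelNetwork.1 hi
    rw [hy.userLevel_eq_resourceLevel hacc hC hn hil] at hs
    exact hsub (mem_acc_levelNetwork.2 ⟨hy.feasible.mem_acc hil, hs⟩)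
  exact ⟨fun l hl => key _ (mem_componentResources.1 hl),
    fun i hi => key _ (mem_componentUsers.1 hi).2⟩

lemma componentUsers_eq (hL : IsTight acc n y s t L) (ht : IsNextLevel acc n y s t)
    (hy : IsBalanced acc C n y) (hacc : ∀ i, (acc i).Nonempty) (hC : ∀ j, 0 < C j)
    (hn : ∀ i, 0 ≤ n i) {j : J} (hj : componentResources y j = L) :
    componentUsers n y j = active n ((levelNetwork acc n y s).inner L) := by
  have hjL : j ∈ L := hj ▸ self_mem_componentResources y j
  ext i
  rw [mem_active]
  refine ⟨fun hi => ⟨(hL.component_subset ht hy hacc hC hn hjL).2 hi,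
    (mem_componentUsers.1 hi).1⟩, fun ⟨hi, hni⟩ => mem_componentUsers.2 ⟨hni, ?_⟩⟩
  obtain ⟨l, hil⟩ := hy.exists_pos_of_active hacc hC hn hni
  obtain ⟨hs, hsub⟩ := mem_inner_levelNetwork.1 hi
  rw [hy.userLevel_eq_resourceLevel hacc hC hn hil] at hs
  have hl : l ∈ L := hsub (mem_acc_levelNetwork.2 ⟨hy.feasible.mem_acc hil, hs⟩)
  rw [← hj] at hl
  exact (mem_componentResources.1 hl).trans (supportGraph_adj_inr_inl.2 hil).reachable

end IsTight

/-! ## Minimal tight sets -/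

/-- Some flow type with a positive rate at `a` could use `b` instead. -/
def CanShift (acc : I → Finset J) (y : I → J → ℝ) (a b : J) : Prop :=
  ∃ i, 0 < y i a ∧ b ∈ acc i

/-- Type `i` moves rate from `a` to `b`, scaled by `(n i)⁻¹` so that one unit of load moves. Its
total is unchanged, and only the positive entry at `a` may decrease. -/
lemma IsBalanced.exists_shift (hy : IsBalanced acc C n y) (hn : ∀ i, 0 ≤ n i) {i : I} {a b : J}
    (ha : 0 < y i a) (hb : b ∈ acc i) :
    ∃ d : I → J → ℝ, (∀ k, ∀ l ∉ acc k, d k l = 0) ∧ (∀ k l, y k l = 0 → 0 ≤ d k l) ∧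
      (∀ k, ∑ l, d k l = 0) ∧
      (∀ l, ∑ k, n k * d k l = (if l = b then 1 else 0) - (if l = a then 1 else 0)) ∧
      (a ≠ b → 0 < d i b) := by
  have hni := hy.active_of_pos hn ha
  have hdv : ∀ k l, ((n i)⁻¹ • (unitDir i b - unitDir i a)) k l =
      (n i)⁻¹ * (unitDir i b k l - unitDir i a k l) := by simp
  refine ⟨(n i)⁻¹ • (unitDir i b - unitDir i a), fun k l hl => ?_, fun k l hl => ?_, fun k => ?_,
    fun l => ?_, fun hab => ?_⟩
  · rw [hdv, unitDir_eq_zero (by rintro ⟨rfl, rfl⟩; exact hl hb),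
      unitDir_eq_zero (by rintro ⟨rfl, rfl⟩; exact hl (hy.feasible.mem_acc ha))]
    simp
  · rw [hdv, unitDir_eq_zero (j := a) (by rintro ⟨rfl, rfl⟩; exact ha.ne' hl), sub_zero]
    exact mul_nonneg (inv_nonneg.2 hni.le) (unitDir_nonneg i b k l)
  · simp only [hdv, ← Finset.mul_sum, Finset.sum_sub_distrib, sum_unitDir, sub_self, mul_zero]
  · have : ∑ k, n k * ((n i)⁻¹ • (unitDir i b - unitDir i a)) k l = (n i)⁻¹ *
        (∑ k, n k * unitDir i b k l - ∑ k, n k * unitDir i a k l) := by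
      rw [← Finset.sum_sub_distrib, Finset.mul_sum]
      refine Finset.sum_congr rfl fun k _ => ?_
      rw [hdv]
      ring
    rw [this, load_unitDir, load_unitDir, mul_sub, mul_ite, mul_ite, inv_mul_cancel₀ hni.ne',
      mul_zero]
  · rw [hdv, unitDir_self, unitDir_eq_zero (fun h => hab h.2.symm), sub_zero, mul_one]
    exact inv_pos.2 hni

/-- Along a chain of shifts the loads telescope: intermediate resources lose what they gain. -/
lemma IsBalanced.exists_shift_of_reflTransGen (hy : IsBalanced acc C n y) (hn : ∀ i, 0 ≤ n i)
    {a b : J} (h : Relation.ReflTransGen (CanShift acc y) a b) :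
    ∃ d : I → J → ℝ, (∀ k, ∀ l ∉ acc k, d k l = 0) ∧ (∀ k l, y k l = 0 → 0 ≤ d k l) ∧
      (∀ k, ∑ l, d k l = 0) ∧
      (∀ l, ∑ k, n k * d k l = (if l = b then 1 else 0) - (if l = a then 1 else 0)) := by
  induction h with
  | refl => exact ⟨0, by simp, by simp, by simp, by simp⟩
  | tail _ hbc ih =>
    obtain ⟨d, h1, h2, h3, h4⟩ := ih
    obtain ⟨i, hib, hic⟩ := hbc
    obtain ⟨e, e1, e2, e3, e4, -⟩ := hy.exists_shift hn hib hic
    refine ⟨d + e, fun k l hl => ?_, fun k l hl => ?_, fun k => ?_, fun l => ?_⟩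
    · simp [h1 k l hl, e1 k l hl]
    · exact add_nonneg (h2 k l hl) (e2 k l hl)
    · simp [Finset.sum_add_distrib, h3 k, e3 k]
    · simp only [Pi.add_apply, mul_add, Finset.sum_add_distrib, h4 l, e4 l]
      ring

/-- Rates can be shifted around a cycle of resources, so that a saturated allocation uses all
pairs on such cycles. -/
lemma IsSaturated.pos_of_cycle (hy : IsSaturated acc C n y) (hn : ∀ i, 0 ≤ n i) {i : I} {a b : J}
    (ha : 0 < y i a) (hb : b ∈ acc i) (h : Relation.ReflTransGen (CanShift acc y) b a) :
    0 < y i b := by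
  by_contra hneg
  have h0 : y i b = 0 := le_antisymm (not_lt.1 hneg) (hy.feasible.apply_nonneg i b)
  have hab : a ≠ b := by
    rintro rfl
    exact hneg ha
  obtain ⟨d, h1, h2, h3, h4⟩ := hy.toIsBalanced.exists_shift_of_reflTransGen hn h
  obtain ⟨e, e1, e2, e3, e4, e5⟩ := hy.toIsBalanced.exists_shift hn ha hb
  have hev := hy.feasible.eventually_add_smul (d := d + e)
    (fun k l hl => by simp [h1 k l hl, e1 k l hl])
    (fun k l hl => add_nonneg (h2 k l hl) (e2 k l hl))
    (fun l _ => by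
      simp only [Pi.add_apply, mul_add, Finset.sum_add_distrib, h4 l, e4 l]
      linarith)
  obtain ⟨ε, hε, hpos⟩ := (hev.and self_mem_nhdsWithin).exists
  refine hneg (hy.pos_of_pos _ hε (funext fun k => ?_) i b ?_)
  · rw [hε.totalRate_eq, hy.feasible.totalRate_eq]
    simp [Finset.sum_add_distrib, ← Finset.mul_sum, h3 k, e3 k]
  · have := h2 i b h0
    have := e5 hab
    simp only [Pi.add_apply, Pi.smul_apply, smul_eq_mul, h0, zero_add]
    exact mul_pos hpos (by linarith)

/-- A tight set without smaller tight sets is a component. -/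
lemma IsTight.componentResources_eq_of_minimal (hL : IsTight acc n y s t L)
    (ht : IsNextLevel acc n y s t) (hy : IsSaturated acc C n y)
    (hacc : ∀ i, (acc i).Nonempty) (hC : ∀ j, 0 < C j) (hn : ∀ i, 0 ≤ n i)
    (hmin : ∀ L' ⊆ L, IsTight acc n y s t L' → L' = L) {j : J} (hj : j ∈ L) :
    componentResources y j = L := by
  classical
  -- Tight sets are the nonempty `E`-closed sets of resources of level `t`. The resources reachable
  -- from a point of `L` form one, so minimality makes `L` strongly connected for `E`.
  set E : J → J → Prop := fun a b => ∃ i, 0 < y i a ∧ b ∈ (levelNetwork acc n y s).acc i with hE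
  have hclosed : ∀ a ∈ L, ({b | Relation.ReflTransGen E a b} : Finset J) = L := by
    intro a ha
    have hsub : ({b | Relation.ReflTransGen E a b} : Finset J) ⊆ L := by
      intro b hb
      simp only [Finset.mem_filter, Finset.mem_univ, true_and] at hb
      induction hb with
      | refl => exact ha
      | tail _ hbc ih =>
        obtain ⟨i, hi, hc⟩ := hbc
        exact hL.acc_subset _ ih i hi hc
    refine hmin _ hsub ⟨⟨a, by simpa using Relation.ReflTransGen.refl⟩,
      fun b hb => hL.level_eq b (hsub hb), fun b hb i hib c hc => ?_⟩
    simp only [Finset.mem_filter, Finset.mem_univ, true_and] at hb ⊢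
    exact hb.tail ⟨i, hib, hc⟩
  have hreach : ∀ {a b}, a ∈ L → (Relation.ReflTransGen E a b ↔ b ∈ L) := fun {a b} ha => by
    rw [← hclosed a ha]
    simp
  refine Finset.Subset.antisymm (hL.component_subset ht hy.toIsBalanced hacc hC hn hj).1
    fun l hl => ?_
  rw [mem_componentResources]
  have hjl := (hreach hj).2 hl
  clear hl
  induction hjl with
  | refl => exact SimpleGraph.Reachable.refl _
  | tail hjb hbc ih =>
    rename_i b c
    have hb := (hreach hj).1 hjb
    have hc := (hreach hj).1 (hjb.tail hbc)
    obtain ⟨i, hib, hic⟩ := hbc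
    -- A return path from `c` to `b` closes the edge to a cycle, so the type behind this edge also
    -- has a positive rate at `c`.
    have hcyc : Relation.ReflTransGen (CanShift acc y) c b :=
      Relation.ReflTransGen.mono (r := E) (p := CanShift acc y)
        (fun _ _ ⟨k, hk, hk'⟩ => ⟨k, hk, (mem_acc_levelNetwork.1 hk').1⟩) _ _ ((hreach hc).2 hb)
    have hpos := hy.pos_of_cycle hn hib (mem_acc_levelNetwork.1 hic).1 hcyc
    exact ih.trans ((supportGraph_adj_inr_inl.2 hib).reachable.trans
      (supportGraph_adj_inl_inr.2 hpos).reachable)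

/-! ## Minimisers and clusters -/

namespace IsNextLevel

lemma mem_acc_of_pos (ht : IsNextLevel acc n y s t) (hy : IsBalanced acc C n y) {i : I} {j : J}
    (hj : resourceLevel acc n y j = t) (hij : 0 < y i j) :
    j ∈ (levelNetwork acc n y s).acc i :=
  mem_acc_levelNetwork.2 ⟨hy.feasible.mem_acc hij, hj ▸ ht.lt⟩

lemma resourceLevel_eq_of_mem_acc (ht : IsNextLevel acc n y s t) {i : I} {j : J}
    (hi : userLevel acc n y i = t) (hj : j ∈ (levelNetwork acc n y s).acc i) :
    resourceLevel acc n y j = t := by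
  obtain ⟨hj, hs⟩ := mem_acc_levelNetwork.1 hj
  exact le_antisymm (hi ▸ resourceLevel_le_userLevel hj) (ht.le_of_lt j hs)

/-- A user of the component cannot reach any other component, by `hcross`. -/
lemma isTight_component (ht : IsNextLevel acc n y s t) (hy : IsBalanced acc C n y)
    (hacc : ∀ i, (acc i).Nonempty) (hC : ∀ j, 0 < C j) (hn : ∀ i, 0 ≤ n i)
    (hcross : ∀ i, userLevel acc n y i = t → ∀ a ∈ (levelNetwork acc n y s).acc i,
      ∀ b ∈ (levelNetwork acc n y s).acc i, componentResources y a = componentResources y b)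
    {j : J} (hj : resourceLevel acc n y j = t) :
    IsTight acc n y s t (componentResources y j) := by
  have hlev : ∀ l ∈ componentResources y j, resourceLevel acc n y l = t := fun l hl =>
    (hy.resourceLevel_eq_of_mem hacc hC hn hl).trans hj
  refine ⟨⟨j, self_mem_componentResources y j⟩, hlev, fun l hl i hil m hm => ?_⟩
  rw [← componentResources_eq hl, ← hcross i
    ((hy.userLevel_eq_resourceLevel hacc hC hn hil).trans (hlev l hl)) m hm l
    (ht.mem_acc_of_pos hy (hlev l hl) hil)]
  exact self_mem_componentResources y m

/-- A strongly connected tight subset through `j` contains the component of `j`, hence is all of it.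
-/
lemma component_mem_minimisers (ht : IsNextLevel acc n y s t) (hy : IsBalanced acc C n y)
    (hacc : ∀ i, (acc i).Nonempty) (hC : ∀ j, 0 < C j) (hn : ∀ i, 0 ≤ n i) {j : J}
    (hT : IsTight acc n y s t (componentResources y j)) :
    componentResources y j ∈ (levelNetwork acc n y s).minimisers C n := by
  obtain ⟨L, hsub, hjL, hs, hL⟩ := hT.exists_strong ht hy hacc hC hn
    (self_mem_componentResources y j)
  have := Finset.Subset.antisymm hsub (hL.component_subset ht hy hacc hC hn hjL).1
  rw [this] at hs hL
  exact (ht.mem_minimisers hy hacc hC hn).2 ⟨hs, hL⟩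

lemma component_eq_of_mem_minimisers (ht : IsNextLevel acc n y s t) (hy : IsBalanced acc C n y)
    (hacc : ∀ i, (acc i).Nonempty) (hC : ∀ j, 0 < C j) (hn : ∀ i, 0 ≤ n i)
    (hcross : ∀ i, userLevel acc n y i = t → ∀ a ∈ (levelNetwork acc n y s).acc i,
      ∀ b ∈ (levelNetwork acc n y s).acc i, componentResources y a = componentResources y b)
    (hL : L ∈ (levelNetwork acc n y s).minimisers C n) {j : J} (hj : j ∈ L) :
    componentResources y j = L := by
  obtain ⟨hs, hT⟩ := (ht.mem_minimisers hy hacc hC hn).1 hL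
  have hsub := (hT.component_subset ht hy hacc hC hn hj).1
  by_contra hne
  have hne' : (L \ componentResources y j).Nonempty := by
    rw [Finset.sdiff_nonempty]
    exact fun h => hne (Finset.Subset.antisymm hsub h)
  -- If `L` had more than one component, this one and the rest would disconnect it, since by
  -- `hcross` no confined type meets both parts.
  refine (mem_strong_levelNetwork.1 hs).2.2 ⟨componentResources y j, L \ componentResources y j,
    ⟨j, self_mem_componentResources y j⟩, hne', Finset.disjoint_sdiff,
    Finset.union_sdiff_of_subset hsub,
    {i ∈ (levelNetwork acc n y s).inner L |
      ¬ Disjoint ((levelNetwork acc n y s).acc i) (componentResources y j)},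
    {i ∈ (levelNetwork acc n y s).inner L |
      Disjoint ((levelNetwork acc n y s).acc i) (componentResources y j)}, ?_, ?_, ?_, ?_⟩
  · exact (Finset.disjoint_filter_filter_not _ _ _).symm
  · rw [Finset.union_comm]
    exact Finset.filter_union_filter_not_eq _ _
  · intro i hi
    obtain ⟨hi, hd⟩ := Finset.mem_filter.1 hi
    obtain ⟨a, ha, haj⟩ := Finset.not_disjoint_iff.1 hd
    refine Finset.disjoint_left.2 fun b hb hbL => (Finset.mem_sdiff.1 hbL).2 ?_
    rw [← componentResources_eq haj, hcross i (ht.userLevel_eq hT.level_eq hi) a ha b hb]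
    exact self_mem_componentResources y b
  · exact fun i hi => (Finset.mem_filter.1 hi).2

lemma component_eq_of_forall_mem_minimisers (ht : IsNextLevel acc n y s t)
    (hy : IsBalanced acc C n y)
    (hacc : ∀ i, (acc i).Nonempty) (hC : ∀ j, 0 < C j) (hn : ∀ i, 0 ≤ n i)
    (h1 : ∀ j, resourceLevel acc n y j = t →
      componentResources y j ∈ (levelNetwork acc n y s).minimisers C n)
    (h2 : ∀ L ∈ (levelNetwork acc n y s).minimisers C n, ∃ j, L = componentResources y j)
    {i : I} (hi : userLevel acc n y i = t) {a b : J} (ha : a ∈ (levelNetwork acc n y s).acc i)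
    (hb : b ∈ (levelNetwork acc n y s).acc i) :
    componentResources y a = componentResources y b := by
  -- The union of the clusters that `i` meets. It is shown to be a minimiser, hence a single
  -- component.
  set W := ((levelNetwork acc n y s).acc i).biUnion (componentResources y) with hW
  have hmem : ∀ {c}, c ∈ (levelNetwork acc n y s).acc i → componentResources y c ⊆ W := fun {c} hc =>
    Finset.subset_biUnion_of_mem _ hc
  have hmin : ∀ {c}, c ∈ (levelNetwork acc n y s).acc i →
      componentResources y c ∈ (levelNetwork acc n y s).strong ∧
        IsTight acc n y s t (componentResources y c) := fun {c} hc =>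
    (ht.mem_minimisers hy hacc hC hn).1 (h1 c (ht.resourceLevel_eq_of_mem_acc hi hc))
  have hT : IsTight acc n y s t W := by
    refine ⟨⟨a, hmem ha (self_mem_componentResources y a)⟩, fun l hl => ?_, fun l hl k hkl => ?_⟩
    · obtain ⟨c, hc, hlc⟩ := Finset.mem_biUnion.1 hl
      exact (hmin hc).2.level_eq l hlc
    · obtain ⟨c, hc, hlc⟩ := Finset.mem_biUnion.1 hl
      exact ((hmin hc).2.acc_subset l hlc k hkl).trans (hmem hc)
  have hiW : i ∈ (levelNetwork acc n y s).inner W :=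
    mem_inner_levelNetwork.2 ⟨hi ▸ ht.lt, fun c hc => hmem hc (self_mem_componentResources y c)⟩
  -- If `i` were on the side of `A`, all its resources would lie in `A`. A cluster reaching into `B`
  -- also contains a resource of `i`, so the partition would disconnect this cluster, which is
  -- strongly connected.
  have part : ∀ A B : Finset J, B.Nonempty → Disjoint A B → A ∪ B = W →
      ∀ P Q : Finset I, Disjoint P Q → P ∪ Q = (levelNetwork acc n y s).inner W →
      (∀ k ∈ P, Disjoint ((levelNetwork acc n y s).acc k) B) →
      (∀ k ∈ Q, Disjoint ((levelNetwork acc n y s).acc k) A) → i ∉ P := by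
    rintro A B ⟨l, hl⟩ hAB hABW P Q hPQ hPQW hP hQ hiP
    obtain ⟨c, hc, hlc⟩ := Finset.mem_biUnion.1 (hABW ▸ Finset.mem_union_right A hl)
    have hcA : c ∈ A := by
      have := hmem hc (self_mem_componentResources y c)
      rw [← hABW, Finset.mem_union] at this
      exact this.resolve_right (Finset.disjoint_left.1 (hP i hiP) hc)
    refine (mem_strong_levelNetwork.1 (hmin hc).1).2.2
      ⟨componentResources y c ∩ A, componentResources y c ∩ B,
      ⟨c, Finset.mem_inter.2 ⟨self_mem_componentResources y c, hcA⟩⟩,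
      ⟨l, Finset.mem_inter.2 ⟨hlc, hl⟩⟩,
      hAB.mono Finset.inter_subset_right Finset.inter_subset_right, ?_,
      (levelNetwork acc n y s).inner (componentResources y c) ∩ P,
      (levelNetwork acc n y s).inner (componentResources y c) ∩ Q,
      hPQ.mono Finset.inter_subset_right Finset.inter_subset_right, ?_,
      fun k hk => (hP k (Finset.mem_inter.1 hk).2).mono_right Finset.inter_subset_right,
      fun k hk => (hQ k (Finset.mem_inter.1 hk).2).mono_right Finset.inter_subset_right⟩
    · rw [← Finset.inter_union_distrib_left, hABW]
      exact Finset.inter_eq_left.2 (hmem hc)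
    · rw [← Finset.inter_union_distrib_left, hPQW]
      refine Finset.inter_eq_left.2 fun k hk => ?_
      obtain ⟨hk, hsub⟩ := mem_inner_levelNetwork.1 hk
      exact mem_inner_levelNetwork.2 ⟨hk, hsub.trans (hmem hc)⟩
  have hWmin : W ∈ (levelNetwork acc n y s).minimisers C n := by
    refine (ht.mem_minimisers hy hacc hC hn).2 ⟨mem_strong_levelNetwork.2
      ⟨ht.subset_resources hT, hT.nonempty, ?_⟩, hT⟩
    rintro ⟨J₁, J₂, hJ₁, hJ₂, hd, hun, I₁, I₂, hdI, hI, hh₁, hh₂⟩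
    rcases Finset.mem_union.1 (hI.symm ▸ hiW) with h | h
    · exact part J₁ J₂ hJ₂ hd hun I₁ I₂ hdI hI hh₁ hh₂ h
    · exact part J₂ J₁ hJ₁ hd.symm ((Finset.union_comm _ _).trans hun) I₂ I₁ hdI.symm
        ((Finset.union_comm _ _).trans hI) hh₂ hh₁ h
  obtain ⟨w, hw⟩ := h2 W hWmin
  have hcomp : ∀ {c}, c ∈ (levelNetwork acc n y s).acc i →
      componentResources y c = componentResources y w := fun {c} hc => by
    have := hmem hc (self_mem_componentResources y c)
    rw [hw] at this
    exact componentResources_eq this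
  rw [hcomp ha, hcomp hb]

end IsNextLevel

/-! ## The steps of the algorithm -/

/-- The positive values of `f` in increasing order, after `0`. -/
noncomputable def levelSeq (f : J → ℝ≥0∞) : ℕ → ℝ≥0∞
  | 0 => 0
  | k + 1 => ⨅ j, ⨅ _ : levelSeq f k < f j, f j

lemma levelSeq_succ_spec {f : J → ℝ≥0∞} {k : ℕ} (h : ∃ j, levelSeq f k < f j) :
    levelSeq f k < levelSeq f (k + 1) ∧
      (∀ j, levelSeq f k < f j → levelSeq f (k + 1) ≤ f j) ∧ ∃ j, f j = levelSeq f (k + 1) := by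
  obtain ⟨j₁, hj₁⟩ := h
  obtain ⟨j₀, hj₀, hmin⟩ := Finset.exists_min_image ({j | levelSeq f k < f j} : Finset J) f
    ⟨j₁, by simpa using hj₁⟩
  simp only [Finset.mem_filter, Finset.mem_univ, true_and] at hj₀ hmin
  have heq : levelSeq f (k + 1) = f j₀ := by
    rw [levelSeq]
    exact le_antisymm (iInf₂_le j₀ hj₀) (le_iInf₂ hmin)
  rw [heq]
  exact ⟨hj₀, hmin, j₀, rfl⟩

lemma exists_last_levelSeq (f : J → ℝ≥0∞) :
    ∃ K, (∀ j, f j ≤ levelSeq f K) ∧ ∀ k < K, ∃ j, levelSeq f k < f j := by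
  classical
  have hex : ∃ K, ∀ j, f j ≤ levelSeq f K := by
    by_contra! h
    have hmono : StrictMono (levelSeq f) := strictMono_nat_of_lt_succ fun k =>
      (levelSeq_succ_spec (h k)).1
    choose g hg using fun k => (levelSeq_succ_spec (h k)).2.2
    -- An unending strictly increasing sequence of values would need infinitely many resources.
    refine not_injective_infinite_finite g fun a b hab => ?_
    have := hg a
    rw [hab, hg b] at this
    have := hmono.injective this
    omega
  refine ⟨Nat.find hex, Nat.find_spec hex, fun k hk => ?_⟩
  have := Nat.find_min hex hk
  push Not at this
  exact this

lemma levelSeq_lt {f : J → ℝ≥0∞} {K : ℕ} (hK : ∀ k < K, ∃ j, levelSeq f k < f j) {k l : ℕ}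
    (hkl : k < l) (hl : l ≤ K) : levelSeq f k < levelSeq f l := by
  induction l, hkl using Nat.le_induction with
  | base => exact (levelSeq_succ_spec (hK k (by omega))).1
  | succ l _ ih => exact (ih (by omega)).trans (levelSeq_succ_spec (hK l (by omega))).1

/-- Only `hle` ties `v` to the sequence, so this covers levels of resources and of types alike: a
value missed by the sequence would exceed each of its terms in turn, up to the last. -/
lemma existsUnique_levelSeq_eq {f : J → ℝ≥0∞} {K : ℕ} (hK : ∀ k < K, ∃ j, levelSeq f k < f j)
    {v : ℝ≥0∞} (h0 : 0 < v) (hv : v ≤ levelSeq f K)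
    (hle : ∀ k < K, levelSeq f k < v → levelSeq f (k + 1) ≤ v) :
    ∃! k, k < K ∧ v = levelSeq f (k + 1) := by
  have hex : ∃ k, k < K ∧ v = levelSeq f (k + 1) := by
    by_contra! h
    have : ∀ k ≤ K, levelSeq f k < v := by
      intro k
      induction k with
      | zero => exact fun _ => h0
      | succ k ih => exact fun hk => (hle k hk (ih (by omega))).lt_of_ne (h k hk).symm
    exact (this K le_rfl).not_ge hv
  obtain ⟨k, hk, hkv⟩ := hex
  refine ⟨k, ⟨hk, hkv⟩, fun l ⟨hl, hlv⟩ => ?_⟩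
  have heq := hkv.symm.trans hlv
  rcases lt_trichotomy l k with h | h | h
  · exact absurd heq (levelSeq_lt hK (by omega) hk).ne'
  · exact h
  · exact absurd heq (levelSeq_lt hK (by omega) hl).ne

lemma isDone_levelNetwork_iff :
    (levelNetwork acc n y s).IsDone ↔ ∀ j, resourceLevel acc n y j ≤ s := by
  simp only [Network.IsDone, Finset.eq_empty_iff_forall_notMem, mem_resources_levelNetwork,
    mem_users_levelNetwork, not_lt]
  exact ⟨fun h => h.1, fun h => ⟨h, fun i => Finset.sup_le fun j _ => h j⟩⟩

/-- All levels are positive, so level `0` removes nothing. -/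
lemma stage_zero_eq (hy : IsBalanced acc C n y) (hacc : ∀ i, (acc i).Nonempty)
    (hC : ∀ j, 0 < C j) (hn : ∀ i, 0 ≤ n i) : stage acc C n 0 = levelNetwork acc n y 0 := by
  have hr := hy.resourceLevel_pos hC hn
  have hu : ∀ i, 0 < userLevel acc n y i := fun i => by
    obtain ⟨j, hj⟩ := hacc i
    exact lt_userLevel_iff.2 ⟨j, hj, hr j⟩
  simp [stage, levelNetwork, hr, hu]

lemma stage_eq (hy : IsBalanced acc C n y) (hacc : ∀ i, (acc i).Nonempty)
    (hC : ∀ j, 0 < C j) (hn : ∀ i, 0 ≤ n i) {K : ℕ}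
    (hK : ∀ k < K, ∃ j, levelSeq (resourceLevel acc n y) k < resourceLevel acc n y j) :
    ∀ k ≤ K, stage acc C n k = levelNetwork acc n y (levelSeq (resourceLevel acc n y) k) := by
  intro k
  induction k with
  | zero => exact fun _ => stage_zero_eq hy hacc hC hn
  | succ k ih =>
    intro hk
    obtain ⟨h1, h2, h3⟩ := levelSeq_succ_spec (hK k hk)
    rw [stage, ih (by omega), IsNextLevel.next_eq ⟨h1, h2, h3⟩ hy hacc hC hn]

end RateAllocation

/-! ### The theorem -/

open RateAllocation

theorem theorem1 {I J : Type*} [Fintype I] [Fintype J] [DecidableEq I] [DecidableEq J]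
    (acc : I → Finset J) (C : J → ℝ) (n : I → ℝ) (U : ℝ → EReal)
    (hacc : ∀ i, (acc i).Nonempty) (hC : ∀ j, 0 < C j) (hn : ∀ i, 0 ≤ n i)
    (hU : RateAllocation.IsUtility U) :
    ∃ (K : ℕ) (x : I → ℝ),
      -- the algorithm stops after exactly `K` steps, and the minimum exists at each of them
      (∀ k < K, ¬ (RateAllocation.stage acc C n k).IsDone ∧
        ((RateAllocation.stage acc C n k).minimisers C n).Nonempty) ∧
      (RateAllocation.stage acc C n K).IsDone ∧
      -- each flow type and each resource is removed at exactly one step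
      (∀ i, ∃! k, k < K ∧ i ∈ (RateAllocation.stage acc C n k).levelUsers C n) ∧
      (∀ j, ∃! k, k < K ∧ j ∈ (RateAllocation.stage acc C n k).levelResources C n) ∧
      -- `x` is the optimal rate vector
      (∀ x', RateAllocation.IsOptimalRate acc C n U x' ↔ x' = x) ∧
      -- and it is the one that the algorithm assigns
      (∀ i, n i = 0 → x i = 0) ∧
      (∀ k < K, ∀ i ∈ (RateAllocation.stage acc C n k).levelUsers C n, 0 < n i →
        ENNReal.ofReal (x i) = (RateAllocation.stage acc C n k).minRate C n) ∧
      -- the minima strictly increase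
      (∀ k l, k < l → l < K → (RateAllocation.stage acc C n k).minRate C n <
        (RateAllocation.stage acc C n l).minRate C n) ∧
      -- every cluster is at the level given by one of the minima
      (∀ I' J', RateAllocation.IsCluster acc C n U I' J' → ∃ k < K,
        RateAllocation.IsClusterAtLevel acc C n U x
          ((RateAllocation.stage acc C n k).minRate C n) I' J') ∧
      -- the sets found at a step are the union of all clusters at the corresponding level
      (∀ k < K,
        (∀ j, j ∈ (RateAllocation.stage acc C n k).levelResources C n ↔
          ∃ I' J', RateAllocation.IsClusterAtLevel acc C n U x
            ((RateAllocation.stage acc C n k).minRate C n) I' J' ∧ j ∈ J') ∧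
        (∀ i, i ∈ RateAllocation.active n ((RateAllocation.stage acc C n k).levelUsers C n) ↔
          ∃ I' J', RateAllocation.IsClusterAtLevel acc C n U x
            ((RateAllocation.stage acc C n k).minRate C n) I' J' ∧ i ∈ I')) ∧
      -- every minimiser is, with its flow types, a union of clusters of that level
      (∀ k < K, ∀ L ∈ (RateAllocation.stage acc C n k).minimisers C n,
        (∀ j, j ∈ L ↔ ∃ I' J', RateAllocation.IsClusterAtLevel acc C n U x
            ((RateAllocation.stage acc C n k).minRate C n) I' J' ∧ j ∈ J' ∧ J' ⊆ L ∧
            I' ⊆ (RateAllocation.stage acc C n k).inner L) ∧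
        (∀ i, i ∈ RateAllocation.active n ((RateAllocation.stage acc C n k).inner L) ↔
          ∃ I' J', RateAllocation.IsClusterAtLevel acc C n U x
            ((RateAllocation.stage acc C n k).minRate C n) I' J' ∧ i ∈ I' ∧ J' ⊆ L ∧
            I' ⊆ (RateAllocation.stage acc C n k).inner L)) ∧
      -- the inclusion-minimal minimisers are, with their flow types, clusters
      (∀ k < K, ∀ L, Minimal (· ∈ (RateAllocation.stage acc C n k).minimisers C n) L →
        RateAllocation.IsCluster acc C n U
          (RateAllocation.active n ((RateAllocation.stage acc C n k).inner L)) L) ∧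
      -- the minimisers with their flow types are exactly the clusters of that level if and only
      -- if no flow type of the level can use resources of two different clusters of the level
      (∀ k < K,
        (∀ I' J', RateAllocation.IsClusterAtLevel acc C n U x
            ((RateAllocation.stage acc C n k).minRate C n) I' J' ↔
          J' ∈ (RateAllocation.stage acc C n k).minimisers C n ∧
            I' = RateAllocation.active n ((RateAllocation.stage acc C n k).inner J')) ↔
        (∀ i ∈ (RateAllocation.stage acc C n k).levelUsers C n, ∀ I₁ J₁ I₂ J₂,
          RateAllocation.IsClusterAtLevel acc C n U x
            ((RateAllocation.stage acc C n k).minRate C n) I₁ J₁ →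
          RateAllocation.IsClusterAtLevel acc C n U x
            ((RateAllocation.stage acc C n k).minRate C n) I₂ J₂ →
          ¬ Disjoint ((RateAllocation.stage acc C n k).acc i) J₁ →
          ¬ Disjoint ((RateAllocation.stage acc C n k).acc i) J₂ → J₁ = J₂)) := by
  classical
  obtain ⟨y, hsat⟩ := exists_isSaturated hacc hC hn
  have hy := hsat.toIsBalanced
  have hopt : ∀ z, IsOptimalSplit acc C n U z ↔
      IsFeasible acc C n z ∧ totalRate acc z = totalRate acc y := fun z =>
    hy.isOptimalSplit_iff hU hacc hC hn
  -- The support of `y` contains that of every optimal allocation, so it alone decides which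
  -- vertices are joined.
  have hJ : ∀ v w, Joined acc C n U v w ↔ (supportGraph y).Reachable v w := by
    refine fun v w => ⟨fun ⟨z, hz, hr⟩ => ?_, fun h => ⟨y, (hopt y).2 ⟨hy.feasible, rfl⟩, h⟩⟩
    obtain ⟨hz, hzy⟩ := (hopt z).1 hz
    exact of_reachable_supportGraph (P := fun w => (supportGraph y).Reachable v w)
      (fun i j hij hv => hv.trans
        (supportGraph_adj_inl_inr.2 (hsat.pos_of_pos z hz hzy i j hij)).reachable)
      (fun i j hij hv => hv.trans
        (supportGraph_adj_inr_inl.2 (hsat.pos_of_pos z hz hzy i j hij)).reachable)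
      hr (SimpleGraph.Reachable.refl v)
  have hlevel : ∀ {I' J' ρ}, IsClusterAtLevel acc C n U (totalRate acc y) ρ I' J' ↔
      ∃ j, resourceLevel acc n y j = ρ ∧ I' = componentUsers n y j ∧
        J' = componentResources y j := fun {I' J' ρ} => hy.isClusterAtLevel_iff hacc hC hn hJ
  obtain ⟨K, hlast, hK⟩ := exists_last_levelSeq (resourceLevel acc n y)
  set σ := levelSeq (resourceLevel acc n y) with hσ
  have hst : ∀ k ≤ K, stage acc C n k = levelNetwork acc n y (σ k) := stage_eq hy hacc hC hn hK
  have hnext : ∀ k < K, IsNextLevel acc n y (σ k) (σ (k + 1)) := fun k hk =>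
    ⟨(levelSeq_succ_spec (hK k hk)).1, (levelSeq_succ_spec (hK k hk)).2.1,
      (levelSeq_succ_spec (hK k hk)).2.2⟩
  -- Stage `k` holds what lies above `σ k`, hence the shifted index of its minimum.
  have hmin : ∀ k < K, (stage acc C n k).minRate C n = σ (k + 1) := fun k hk => by
    rw [hst k hk.le, (hnext k hk).minRate_eq hy hacc hC hn]
  have hres : ∀ k < K, ∀ j, j ∈ (stage acc C n k).levelResources C n ↔
      resourceLevel acc n y j = σ (k + 1) := fun k hk j => by
    rw [hst k hk.le, (hnext k hk).mem_levelResources hy hacc hC hn]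
  have husr : ∀ k < K, ∀ i, i ∈ (stage acc C n k).levelUsers C n ↔
      userLevel acc n y i = σ (k + 1) := fun k hk i => by
    rw [hst k hk.le, (hnext k hk).mem_levelUsers hy hacc hC hn]
  have hjpos := hy.resourceLevel_pos hC hn
  have hresUnique : ∀ j, ∃! k, k < K ∧ resourceLevel acc n y j = σ (k + 1) := fun j =>
    existsUnique_levelSeq_eq hK (hjpos j) (hlast j) fun k hk h => (hnext k hk).le_of_lt j h
  refine ⟨K, totalRate acc y, fun k hk => ⟨?_, ?_⟩, ?_, fun i => ?_, fun j => ?_, fun x' => ?_,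
    fun i hi => hy.totalRate_eq_zero hi, fun k hk i hi hni => ?_, fun k l hkl hl => ?_,
    fun I' J' h => ?_, fun k hk => ⟨fun j => ?_, fun i => ?_⟩, fun k hk L hL => ?_,
    fun k hk L hL => ?_, fun k hk => ?_⟩
  · rw [hst k hk.le, isDone_levelNetwork_iff]
    obtain ⟨j, hj⟩ := hK k hk
    exact fun h => (h j).not_gt hj
  · obtain ⟨j, hj⟩ := (hnext k hk).exists_eq
    obtain ⟨L, hL, -⟩ := Finset.mem_biUnion.1 ((hres k hk j).2 hj)
    exact ⟨L, hL⟩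
  · rw [hst K le_rfl, isDone_levelNetwork_iff]
    exact hlast
  · obtain ⟨j, hj⟩ := hacc i
    obtain ⟨k, ⟨hk, hi⟩, huniq⟩ := existsUnique_levelSeq_eq hK (v := userLevel acc n y i)
      ((hjpos j).trans_le (resourceLevel_le_userLevel hj)) (Finset.sup_le fun j _ => hlast j)
      fun k hk h => (hnext k hk).le_userLevel h
    exact ⟨k, ⟨hk, (husr k hk i).2 hi⟩, fun l hl => huniq l ⟨hl.1, (husr l hl.1 i).1 hl.2⟩⟩
  · obtain ⟨k, ⟨hk, hj⟩, huniq⟩ := hresUnique j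
    exact ⟨k, ⟨hk, (hres k hk j).2 hj⟩, fun l hl => huniq l ⟨hl.1, (hres l hl.1 j).1 hl.2⟩⟩
  · constructor
    · rintro ⟨z, hz, rfl⟩
      exact ((hopt z).1 hz).2
    · rintro rfl
      exact ⟨y, (hopt y).2 ⟨hy.feasible, rfl⟩, rfl⟩
  · rw [hmin k hk, ← hy.userLevel_eq hacc hC hn hni]
    exact (husr k hk i).1 hi
  · rw [hmin k (hkl.trans hl), hmin l hl]
    exact levelSeq_lt hK (by omega) (by omega)
  · obtain ⟨j, rfl, rfl⟩ := (hy.isCluster_iff hacc hC hn hJ).1 h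
    obtain ⟨k, ⟨hk, hj⟩, -⟩ := hresUnique j
    refine ⟨k, hk, ?_⟩
    rw [hmin k hk]
    exact hlevel.2 ⟨j, hj, rfl, rfl⟩
  · rw [hres k hk, hmin k hk]
    constructor
    · exact fun hj => ⟨_, _, hlevel.2 ⟨j, hj, rfl, rfl⟩, self_mem_componentResources y j⟩
    · rintro ⟨I', J', h, hj⟩
      obtain ⟨l, hl, rfl, rfl⟩ := hlevel.1 h
      rw [hy.resourceLevel_eq_of_mem hacc hC hn hj, hl]
  · rw [mem_active, husr k hk, hmin k hk]
    constructor
    · rintro ⟨hi, hni⟩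
      obtain ⟨j, hij⟩ := hy.exists_pos_of_active hacc hC hn hni
      refine ⟨_, _, hlevel.2 ⟨j, ?_, rfl, rfl⟩, mem_componentUsers.2
        ⟨hni, (supportGraph_adj_inr_inl.2 hij).reachable⟩⟩
      rw [← hy.userLevel_eq_resourceLevel hacc hC hn hij, hi]
    · rintro ⟨I', J', h, hi⟩
      obtain ⟨l, hl, rfl, rfl⟩ := hlevel.1 h
      obtain ⟨hni, hr⟩ := mem_componentUsers.1 hi
      exact ⟨(hy.level_eq_of_reachable hacc hC hn hr).symm.trans hl, hni⟩
  · rw [hmin k hk]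
    rw [hst k hk.le] at hL ⊢
    have ht := hnext k hk
    have hT := ((ht.mem_minimisers hy hacc hC hn).1 hL).2
    have hsub : ∀ j ∈ L, componentResources y j ⊆ L ∧
        componentUsers n y j ⊆ (levelNetwork acc n y (σ k)).inner L := fun j hj =>
      hT.component_subset ht hy hacc hC hn hj
    refine ⟨fun j => ⟨fun hj => ⟨_, _, hlevel.2 ⟨j, hT.level_eq j hj, rfl, rfl⟩,
      self_mem_componentResources y j, hsub j hj⟩, fun ⟨_, _, _, hj, hJL, _⟩ => hJL hj⟩,
      fun i => ⟨fun hi => ?_, fun ⟨_, _, h, hi, _, hIL⟩ =>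
        mem_active.2 ⟨hIL hi, h.isCluster.active i hi⟩⟩⟩
    obtain ⟨hi, hni⟩ := mem_active.1 hi
    obtain ⟨j, hij⟩ := hy.exists_pos_of_active hacc hC hn hni
    obtain ⟨hs, hiL⟩ := mem_inner_levelNetwork.1 hi
    rw [hy.userLevel_eq_resourceLevel hacc hC hn hij] at hs
    have hj : j ∈ L := hiL (mem_acc_levelNetwork.2 ⟨hy.feasible.mem_acc hij, hs⟩)
    exact ⟨_, _, hlevel.2 ⟨j, hT.level_eq j hj, rfl, rfl⟩, mem_componentUsers.2
      ⟨hni, (supportGraph_adj_inr_inl.2 hij).reachable⟩, hsub j hj⟩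
  · rw [hst k hk.le] at hL ⊢
    have ht := hnext k hk
    have hT := ((ht.mem_minimisers hy hacc hC hn).1 hL.prop).2
    obtain ⟨j, hj⟩ := hT.nonempty
    -- Minimality among minimisers gives minimality among tight sets, as every tight set contains a
    -- strongly connected one.
    have hcomp := hT.componentResources_eq_of_minimal ht hsat hacc hC hn (fun L' hL' hT' => by
      obtain ⟨j', hj'⟩ := hT'.nonempty
      obtain ⟨M, hM, -, hs, hMT⟩ := hT'.exists_strong ht hy hacc hC hn hj'
      exact Finset.Subset.antisymm hL'
        ((hL.le_of_le ((ht.mem_minimisers hy hacc hC hn).2 ⟨hs, hMT⟩) (hM.trans hL')).trans hM)) hj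
    exact (hy.isCluster_iff hacc hC hn hJ).2
      ⟨j, (hT.componentUsers_eq ht hy hacc hC hn hcomp).symm, hcomp.symm⟩
  · rw [hmin k hk]
    simp only [husr k hk]
    rw [hst k hk.le]
    have ht := hnext k hk
    constructor
    · intro h i hi I₁ J₁ I₂ J₂ h₁ h₂ hd₁ hd₂
      obtain ⟨j₁, -, -, rfl⟩ := hlevel.1 h₁
      obtain ⟨j₂, -, -, rfl⟩ := hlevel.1 h₂
      obtain ⟨a, ha, ha₁⟩ := Finset.not_disjoint_iff.1 hd₁
      obtain ⟨b, hb, hb₂⟩ := Finset.not_disjoint_iff.1 hd₂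
      rw [← componentResources_eq ha₁, ← componentResources_eq hb₂]
      refine ht.component_eq_of_forall_mem_minimisers hy hacc hC hn
        (fun j hj => ((h _ _).1 (hlevel.2 ⟨j, hj, rfl, rfl⟩)).1) (fun L hL => ?_) hi ha hb
      obtain ⟨j, -, -, hj⟩ := hlevel.1 ((h _ _).2 ⟨hL, rfl⟩)
      exact ⟨j, hj⟩
    · intro h I' J'
      have hcross : ∀ i, userLevel acc n y i = σ (k + 1) →
          ∀ a ∈ (levelNetwork acc n y (σ k)).acc i, ∀ b ∈ (levelNetwork acc n y (σ k)).acc i,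
          componentResources y a = componentResources y b := fun i hi a ha b hb =>
        h i hi _ _ _ _
          (hlevel.2 ⟨a, ht.resourceLevel_eq_of_mem_acc hi ha, rfl, rfl⟩)
          (hlevel.2 ⟨b, ht.resourceLevel_eq_of_mem_acc hi hb, rfl, rfl⟩)
          (Finset.not_disjoint_iff.2 ⟨a, ha, self_mem_componentResources y a⟩)
          (Finset.not_disjoint_iff.2 ⟨b, hb, self_mem_componentResources y b⟩)
      constructor
      · intro hcl
        obtain ⟨j, hj, rfl, rfl⟩ := hlevel.1 hcl
        have hT := ht.isTight_component hy hacc hC hn hcross hj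
        exact ⟨ht.component_mem_minimisers hy hacc hC hn hT,
          hT.componentUsers_eq ht hy hacc hC hn rfl⟩
      · rintro ⟨hL, rfl⟩
        have hT := ((ht.mem_minimisers hy hacc hC hn).1 hL).2
        obtain ⟨j, hj⟩ := hT.nonempty
        have hcomp := ht.component_eq_of_mem_minimisers hy hacc hC hn hcross hL hj
        exact hlevel.2 ⟨j, hT.level_eq j hj, (hT.componentUsers_eq ht hy hacc hC hn hcomp).symm,
          hcomp.symm⟩
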